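/- Theorem 3.8. Let $(M,\mathcal T)$ be a connected closed triangulated surface, i.e. the connected quotient of a finite nonempty disjoint union of triangles by identifying all their edges in pairs by homeomorphisms, with sets $V,E,F$ of vertices, unoriented edges and triangles. Let $\varepsilon:V\to\{0,1\}$ and $\eta:E\to\mathbb R$ satisfy the structure conditions $$\varepsilon_s\varepsilon_t+\eta_{st}>0\ \text{ for all }\{st\}\in E,\qquad \varepsilon_q\eta_{st}+\eta_{qs}\eta_{qt}\ge 0\ \text{ whenever }\{q,s,t\}=\{i,j,k\},\ \{ijk\}\in F.$$ For $f\in\mathbb R^V$ (a generalized hyperbolic discrete conformal factor) let the edge lengths $l_{ij}>0$ be given by $$\cosh l_{ij}=\sqrt{(1+\varepsilon_ie^{2f_i})(1+\varepsilon_je^{2f_j})}+\eta_{ij}e^{f_i+f_j},$$ and for a triangle $\{ijk\}\in F$ let the extended inner angle $\widetilde\theta_i^{jk}$ at $i$ be the inner angle at $i$ of the hyperbolic triangle with edge lengths $l_{ij},l_{ik},l_{jk}$ if these satisfy the strict triangle inequalities, $\pi$ if $l_{jk}\ge l_{ij}+l_{ik}$, and $0$ otherwise. Let $\widetilde K_i=2\pi-\sum_{\{ijk\}\in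 F}\widetilde\theta_i^{jk}$ be the extended combinatorial curvature (the sum is over all corners of triangles at the vertex $i$), and put $$u_i=f_i\ \text{ if }\varepsilon_i=0,\qquad u_i=\tfrac12\log\left|\frac{\sqrt{1+\varepsilon_ie^{2f_i}}-1}{\sqrt{1+\varepsilon_ie^{2f_i}}+1}\right|\ \text{ if }\varepsilon_i=1.$$ Let $\overline K:V\to\mathbb R$ be any function. Then for every initial value $f(0)\in\mathbb R^V$ the extended modified hyperbolic combinatorial Ricci flow $$\frac{du_i}{dt}=\overline K_i-\widetilde K_i,\qquad i\in V,$$ has a unique solution: a solution with this initial value exists on $[0,T)$ for some $T>0$, and for every $T\in(0,\infty]$ any two solutions on $[0,T)$ with this initial value coincide on $[0,T)$. -/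

import Mathlib

/-- A side of one of the triangles indexed by `F`, together with one of its two directions.
The corners of every triangle are labelled by `Fin 3`. -/
@[ext]
structure OrientedSide (F : Type*) where
  face : F
  src : Fin 3
  tgt : Fin 3
  ne : src ≠ tgt

/-- The same side with the opposite direction. -/
def OrientedSide.reverse {F : Type*} (e : OrientedSide F) : OrientedSide F :=
  ⟨e.face, e.tgt, e.src, e.ne.symm⟩

/-- The side of the triangle `t` opposite to the corner `a`; it joins the corners `a + 1` and
`a + 2` (indices modulo 3). -/
def oppositeSide {F : Type*} (t : F) (a : Fin 3) : OrientedSide F :=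
  ⟨t, a + 1, a + 2, by revert a; decide⟩

/-- A connected triangulated closed surface: the quotient of a disjoint union of triangles
(indexed by `F`, finite and nonempty wherever it is used) by identifying all their sides in pairs.
An identification of two sides is recorded by what it does to directed sides: `glue e` is the
directed side with which `e` is identified, source with source and target with target.
Both orientable and non-orientable surfaces arise, and neither distinct corners of a triangle nor
distinct sides of a triangle need to remain distinct in the quotient. -/
structure TriangulatedSurface (F : Type*) where
  glue : OrientedSide F → OrientedSide F
  glue_glue : ∀ e, glue (glue e) = e
  glue_reverse : ∀ e, glue e.reverse = (glue e).reverse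
  /-- no side is identified with itself, in either direction -/
  glue_ne : ∀ e, glue e ≠ e ∧ glue e ≠ e.reverse
  connected : ∀ s t : F,
    Relation.ReflTransGen (fun s t : F => ∃ e : OrientedSide F, e.face = s ∧ (glue e).face = t) s t

namespace TriangulatedSurface

variable {F : Type*} (S : TriangulatedSurface F)

/-- The vertices: corners of triangles modulo the identifications (`Quot` divides by the
equivalence relation generated by the given relation). -/
def Vertex : Type _ :=
  Quot (fun c d : F × Fin 3 =>
    ∃ e : OrientedSide F, c = (e.face, e.src) ∧ d = ((S.glue e).face, (S.glue e).src))

/-- The unoriented edges: sides of triangles modulo the identifications. -/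
def Edge : Type _ :=
  Quot (fun e e' : OrientedSide F => e' = e.reverse ∨ e' = S.glue e)

/-- The vertex at the corner `a` of the triangle `t`. -/
def vertexAt (t : F) (a : Fin 3) : S.Vertex := Quot.mk _ (t, a)

/-- The edge on which a side lies. -/
def edgeOf (e : OrientedSide F) : S.Edge := Quot.mk _ e

/-- First structure condition: `ε_s ε_t + η_st > 0` for every edge `st`. -/
def StructureCondition₁ (ε : S.Vertex → ℝ) (η : S.Edge → ℝ) : Prop :=
  ∀ e : OrientedSide F,
    0 < ε (S.vertexAt e.face e.src) * ε (S.vertexAt e.face e.tgt) + η (S.edgeOf e)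

/-- Second structure condition: `ε_q η_st + η_qs η_qt ≥ 0` for every triangle `qst` and each
choice of its corner `q`. -/
def StructureCondition₂ (ε : S.Vertex → ℝ) (η : S.Edge → ℝ) : Prop :=
  ∀ (t : F) (a : Fin 3),
    0 ≤ ε (S.vertexAt t a) * η (S.edgeOf (oppositeSide t a)) +
      η (S.edgeOf (oppositeSide t (a + 1))) * η (S.edgeOf (oppositeSide t (a + 2)))

/-- The hyperbolic length `l_ij` of a side, given by
`cosh l_ij = √((1 + ε_i e^{2 f_i}) (1 + ε_j e^{2 f_j})) + η_ij e^{f_i + f_j}`. -/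
noncomputable def sideLength (ε : S.Vertex → ℝ) (η : S.Edge → ℝ) (f : S.Vertex → ℝ)
    (e : OrientedSide F) : ℝ :=
  let i := S.vertexAt e.face e.src
  let j := S.vertexAt e.face e.tgt
  Real.arcosh (√((1 + ε i * Real.exp (2 * f i)) * (1 + ε j * Real.exp (2 * f j))) +
    η (S.edgeOf e) * Real.exp (f i + f j))

end TriangulatedSurface

/-- The inner angle opposite to the side of length `x` in a nondegenerate hyperbolic triangle with
side lengths `x`, `y`, `z` (hyperbolic law of cosines). -/
noncomputable def hyperbolicAngle (x y z : ℝ) : ℝ :=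
  Real.arccos ((Real.cosh y * Real.cosh z - Real.cosh x) / (Real.sinh y * Real.sinh z))

open Classical in
/-- The extended inner angle opposite to the side of length `x`: the inner angle if the lengths
satisfy the strict triangle inequalities (and hence are positive), `π` on the part of the
degenerate region where the triangle is flat or worse at the angle in question
(`x ≥ y + z`), and `0` on the rest of the degenerate region. -/
noncomputable def extendedAngle (x y z : ℝ) : ℝ :=
  if x < y + z ∧ y < x + z ∧ z < x + y then hyperbolicAngle x y z
  else if y + z ≤ x then Real.pi
  else 0

/-- The coordinate `u_i` as a function of `ε_i` and `f_i`. -/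
noncomputable def uCoord (ε f : ℝ) : ℝ :=
  if ε = 0 then f
  else 1 / 2 * Real.log |(√(1 + ε * Real.exp (2 * f)) - 1) / (√(1 + ε * Real.exp (2 * f)) + 1)|

namespace TriangulatedSurface

variable {F : Type*} (S : TriangulatedSurface F)

/-- The extended inner angle at the corner `a` of the triangle `t`. -/
noncomputable def cornerAngle (ε : S.Vertex → ℝ) (η : S.Edge → ℝ) (f : S.Vertex → ℝ)
    (t : F) (a : Fin 3) : ℝ :=
  extendedAngle (S.sideLength ε η f (oppositeSide t a))
    (S.sideLength ε η f (oppositeSide t (a + 1)))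
    (S.sideLength ε η f (oppositeSide t (a + 2)))

open Classical in
/-- The extended combinatorial curvature at `v`: `2π` minus the sum of the extended inner angles at
all corners of triangles lying at `v`. -/
noncomputable def extendedCurvature [Fintype F] (ε : S.Vertex → ℝ) (η : S.Edge → ℝ)
    (f : S.Vertex → ℝ) (v : S.Vertex) : ℝ :=
  2 * Real.pi - ∑ t : F, ∑ a : Fin 3, if S.vertexAt t a = v then S.cornerAngle ε η f t a else 0

/-- The time interval `[0, T)`, where `T = ∞` is allowed. -/
def timeInterval (T : EReal) : Set ℝ := {t : ℝ | 0 ≤ t ∧ (t : EReal) < T}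

/-- `f : [0, T) → ℝ^V` solves the extended modified hyperbolic combinatorial Ricci flow
`du_i/dt = K̄_i - K̃_i` with initial value `f₀`, where `u` is the coordinate change of `f`
(the derivative at `t = 0` is one-sided; the values of `f` outside `[0, T)` are irrelevant). -/
def IsExtendedRicciFlow [Fintype F] (ε : S.Vertex → ℝ) (η : S.Edge → ℝ)
    (Kbar : S.Vertex → ℝ) (f₀ : S.Vertex → ℝ) (T : EReal) (f : ℝ → S.Vertex → ℝ) : Prop :=
  f 0 = f₀ ∧ ∀ t ∈ timeInterval T, ∀ v : S.Vertex,
    HasDerivWithinAt (fun s : ℝ => uCoord (ε v) (f s v))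
      (Kbar v - S.extendedCurvature ε η (f t) v) (timeInterval T) t

end TriangulatedSurface

/-! In the coordinates `u` the extended curvature is continuous and monotone: `∑ v, (x v - y v) * (K
x v - K y v) ≥ 0`. It need not be Lipschitz where a triangle degenerates, so monotonicity does the
work of a Lipschitz bound. The squared distance between two solutions in `u` cannot increase, which
gives uniqueness. Picard–Lindelöf solutions for smooth approximations of the field form a uniform
Cauchy sequence for the same reason, and their limit is a solution
(`exists_integralCurve_of_monotone`).

Monotonicity is proved for each triangle (`sum_mul_coordAngle_sub_nonpos`). Along the segment
between two coordinate vectors, pair the angles with the direction of the segment. Where the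
triangle is degenerate every angle is `0` or `π`, so the pairing takes one of finitely many values.
Elsewhere its derivative is a negative multiple of `angleForm`. A continuous function of this kind
decreases as soon as `angleForm` is nonnegative (`le_of_hasDerivAt_nonpos_or_mem_finite`).

`angleForm` is a combination of three nonnegative forms, one for each edge, whose weights are
entries of an adjugate applied to a vector. If all weights are nonnegative the claim is clear. The
structure conditions and nondegeneracy allow at most one negative weight
(`not_weightAdjEntry_nonpos_pair`). In that case squares are completed, and the determinant that
remains is a nonnegative multiple of the Jacobian of the edge lengths, whose sign is given by
`edgeDet_nonneg`. -/

/-! ### Algebra of the quadratic form of the angle derivatives. -/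

/-- The determinant of the symmetric matrix with unit diagonal and off-diagonal entries
`a`, `b`, `c`. -/
def gramDet (a b c : ℝ) : ℝ := 1 + 2 * a * b * c - a ^ 2 - b ^ 2 - c ^ 2

/-- First entry of the product of the adjugate of the matrix of `gramDet` with the vector
`(u, v, w)`; the other entries are obtained by cyclic permutation. -/
def adjEntry (a b c u v w : ℝ) : ℝ := (1 - a ^ 2) * u + (a * b - c) * v + (a * c - b) * w

/-- On the left the vector `(x, y, z)` is paired with the angle derivatives, up to their common
factor. Regrouping by edges leaves forms that are nonnegative for `a, b, c > 1`, so that only the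
signs of the weights matter. -/
theorem adjEntry_quotient_form {a b c : ℝ} (u v w x y z : ℝ) (ha : a ^ 2 - 1 ≠ 0)
    (hb : b ^ 2 - 1 ≠ 0) (hc : c ^ 2 - 1 ≠ 0) {da db dc : ℝ}
    (hda : da = (v * a - w) * y + (w * a - v) * z)
    (hdb : db = (w * b - u) * z + (u * b - w) * x)
    (hdc : dc = (u * c - v) * x + (v * c - u) * y) :
    x * (da - db * (a * b - c) / (b ^ 2 - 1) - dc * (a * c - b) / (c ^ 2 - 1)) +
    y * (db - dc * (b * c - a) / (c ^ 2 - 1) - da * (b * a - c) / (a ^ 2 - 1)) +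
    z * (dc - da * (c * a - b) / (a ^ 2 - 1) - db * (c * b - a) / (b ^ 2 - 1)) =
    -(adjEntry a b c u v w / (a ^ 2 - 1) * (a * (y ^ 2 + z ^ 2) - 2 * y * z) +
      adjEntry b c a v w u / (b ^ 2 - 1) * (b * (z ^ 2 + x ^ 2) - 2 * z * x) +
      adjEntry c a b w u v / (c ^ 2 - 1) * (c * (x ^ 2 + y ^ 2) - 2 * x * y)) := by
  subst hda hdb hdc
  unfold adjEntry
  field_simp
  ring

theorem edgeForm_nonneg {a : ℝ} (ha : 1 < a) (y z : ℝ) :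
    0 ≤ a * (y ^ 2 + z ^ 2) - 2 * y * z := by
  nlinarith [sq_nonneg (y - z), mul_nonneg (sub_nonneg.2 ha.le) (add_nonneg (sq_nonneg y) (sq_nonneg z))]

/-- A weighted sum of the three edge forms is nonnegative if it is so on the pair
`(1, 0, 0)`, `(1, c, b)`, which is orthogonal for it, and its determinant is nonnegative. -/
theorem sum_edgeForm_nonneg_of_det {a b c p q r : ℝ}
    (hc : c ≠ 0)
    (hN : 0 < q * b + r * c)
    (hR : 0 < p * (a * (c ^ 2 + b ^ 2) - 2 * c * b) + q * (b * (b ^ 2 - 1)) + r * (c * (c ^ 2 - 1)))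
    (hdet : 0 ≤ p ^ 2 * (a ^ 2 - 1) * (q * b + r * c) + q ^ 2 * (b ^ 2 - 1) * (p * a + r * c) +
      r ^ 2 * (c ^ 2 - 1) * (p * a + q * b) + 2 * p * q * r * (a * b * c - 1))
    (x y z : ℝ) :
    0 ≤ p * (a * (y ^ 2 + z ^ 2) - 2 * y * z) + q * (b * (z ^ 2 + x ^ 2) - 2 * z * x) +
      r * (c * (x ^ 2 + y ^ 2) - 2 * x * y) := by
  set N := q * b + r * c with hNdef
  set R := p * (a * (c ^ 2 + b ^ 2) - 2 * c * b) + q * (b * (b ^ 2 - 1)) +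
    r * (c * (c ^ 2 - 1)) with hRdef
  set D := p ^ 2 * (a ^ 2 - 1) * (q * b + r * c) + q ^ 2 * (b ^ 2 - 1) * (p * a + r * c) +
      r ^ 2 * (c ^ 2 - 1) * (p * a + q * b) + 2 * p * q * r * (a * b * c - 1) with hDdef
  -- Here `(x, y, z) = α (1, 0, 0) + β (1, c, b) + γ (0, 0, 1)`. The first two vectors are
  -- orthogonal for the form, with values `N` and `R`; after completing two squares only the
  -- determinant `D` of the form remains.
  set β := y / c
  set γ := z - β * b
  set α := x - β
  set m := -(p * c) + (p * a + q * b) * b - q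
  have hy : y = β * c := by simp only [β]; field_simp
  have hz : z = β * b + γ := by simp only [γ]; ring
  have hx : x = α + β := by simp only [α]; ring
  have key : N * R * (p * (a * (y ^ 2 + z ^ 2) - 2 * y * z) + q * (b * (z ^ 2 + x ^ 2) - 2 * z * x) +
      r * (c * (x ^ 2 + y ^ 2) - 2 * x * y)) =
      R * (N * α - q * γ) ^ 2 + N * (R * β + m * γ) ^ 2 + γ ^ 2 * (c ^ 2 * D) := by
    rw [hy, hz, hx, hNdef, hRdef, hDdef]
    simp only [m]
    ring
  have h : 0 ≤ N * R * (p * (a * (y ^ 2 + z ^ 2) - 2 * y * z) +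
      q * (b * (z ^ 2 + x ^ 2) - 2 * z * x) + r * (c * (x ^ 2 + y ^ 2) - 2 * x * y)) := by
    rw [key]; positivity
  exact nonneg_of_mul_nonneg_right h (mul_pos hN hR)

/-- The last factor on the right is the determinant of `(x, y, z) ↦ (da, db, dc)` from
`adjEntry_quotient_form`. It appears because the form factors through the derivatives of the edge
lengths. -/
theorem adjEntry_det_identity (a b c u v w : ℝ) :
    adjEntry a b c u v w ^ 2 * (adjEntry b c a v w u * b * (c ^ 2 - 1) +
        adjEntry c a b w u v * c * (b ^ 2 - 1)) +
      adjEntry b c a v w u ^ 2 * (adjEntry a b c u v w * a * (c ^ 2 - 1) +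
        adjEntry c a b w u v * c * (a ^ 2 - 1)) +
      adjEntry c a b w u v ^ 2 * (adjEntry a b c u v w * a * (b ^ 2 - 1) +
        adjEntry b c a v w u * b * (a ^ 2 - 1)) +
      2 * adjEntry a b c u v w * adjEntry b c a v w u * adjEntry c a b w u v * (a * b * c - 1) =
    gramDet a b c ^ 2 * ((v * a - w) * (w * b - u) * (u * c - v) +
      (w * a - v) * (u * b - w) * (v * c - u)) := by
  unfold adjEntry gramDet
  ring

/-- No sign is required of the first weight. The value at `(1, c, b)` collapses to a positive
multiple of `gramDet`, and the determinant to a multiple of the expression in `hK`. -/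
theorem sum_edgeForm_nonneg_of_neg {a b c u v w : ℝ} (ha : 1 < a) (hb : 1 < b) (hc : 1 < c)
    (hΔ : 0 < gramDet a b c)
    (hq : 0 < adjEntry b c a v w u) (hr : 0 < adjEntry c a b w u v)
    (h12 : 0 < v * a - w) (h13 : 0 < w * a - v)
    (hK : 0 ≤ (v * a - w) * (w * b - u) * (u * c - v) + (w * a - v) * (u * b - w) * (v * c - u))
    (x y z : ℝ) :
    0 ≤ adjEntry a b c u v w / (a ^ 2 - 1) * (a * (y ^ 2 + z ^ 2) - 2 * y * z) +
      adjEntry b c a v w u / (b ^ 2 - 1) * (b * (z ^ 2 + x ^ 2) - 2 * z * x) +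
      adjEntry c a b w u v / (c ^ 2 - 1) * (c * (x ^ 2 + y ^ 2) - 2 * x * y) := by
  have hA : 0 < a ^ 2 - 1 := by nlinarith
  have hB : 0 < b ^ 2 - 1 := by nlinarith
  have hC : 0 < c ^ 2 - 1 := by nlinarith
  apply sum_edgeForm_nonneg_of_det (by positivity)
  · positivity
  · have : adjEntry a b c u v w / (a ^ 2 - 1) * (a * (c ^ 2 + b ^ 2) - 2 * c * b) +
        adjEntry b c a v w u / (b ^ 2 - 1) * (b * (b ^ 2 - 1)) +
        adjEntry c a b w u v / (c ^ 2 - 1) * (c * (c ^ 2 - 1)) =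
        gramDet a b c * (c * (v * a - w) + b * (w * a - v)) / (a ^ 2 - 1) := by
      unfold adjEntry gramDet
      field_simp
      ring
    rw [this]
    positivity
  · have : ∀ P Q R A B C : ℝ, 0 < A → 0 < B → 0 < C →
        (P / A) ^ 2 * A * (Q / B * b + R / C * c) + (Q / B) ^ 2 * B * (P / A * a + R / C * c) +
          (R / C) ^ 2 * C * (P / A * a + Q / B * b) + 2 * (P / A) * (Q / B) * (R / C) * (a * b * c - 1)
        = (P ^ 2 * (Q * b * C + R * c * B) + Q ^ 2 * (P * a * C + R * c * A) +
          R ^ 2 * (P * a * B + Q * b * A) + 2 * P * Q * R * (a * b * c - 1)) / (A * B * C) := by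
      intro P Q R A B C h1 h2 h3
      field_simp
    rw [this _ _ _ _ _ _ hA hB hC, adjEntry_det_identity]
    positivity

/-! ### Signs forced by the structure conditions. -/

/-- The structure conditions for the weights of a single triangle; `hᵢ` is the weight of the edge
opposite to the `i`-th corner. -/
structure IsTriangleWeight (e₁ e₂ e₃ h₁ h₂ h₃ : ℝ) : Prop where
  e₁_mem : e₁ = 0 ∨ e₁ = 1
  e₂_mem : e₂ = 0 ∨ e₂ = 1
  e₃_mem : e₃ = 0 ∨ e₃ = 1
  pos₁ : 0 < e₂ * e₃ + h₁
  pos₂ : 0 < e₃ * e₁ + h₂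
  pos₃ : 0 < e₁ * e₂ + h₃
  nonneg₁ : 0 ≤ e₁ * h₁ + h₂ * h₃
  nonneg₂ : 0 ≤ e₂ * h₂ + h₃ * h₁
  nonneg₃ : 0 ≤ e₃ * h₃ + h₁ * h₂

theorem IsTriangleWeight.rotate {e₁ e₂ e₃ h₁ h₂ h₃ : ℝ}
    (H : IsTriangleWeight e₁ e₂ e₃ h₁ h₂ h₃) : IsTriangleWeight e₂ e₃ e₁ h₂ h₃ h₁ :=
  ⟨H.e₂_mem, H.e₃_mem, H.e₁_mem, H.pos₂, H.pos₃, H.pos₁, H.nonneg₂, H.nonneg₃, H.nonneg₁⟩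

/-- The relation between the two scales at a vertex: in terms of the conformal factor `f`,
`k = e^{-f}` and `t = k √(1 + e k⁻²)`. -/
structure IsVertexScale (e k t : ℝ) : Prop where
  e_mem : e = 0 ∨ e = 1
  k_pos : 0 < k
  t_pos : 0 < t
  sq_eq : t ^ 2 = k ^ 2 + e

/-- The hyperbolic cosine of the length of an edge. -/
noncomputable def coshLength (h k t k' t' : ℝ) : ℝ := (t * t' + h) / (k * k')

/-- First entry of the product of the adjugate of the matrix with diagonal entries `-eᵢ` and
off-diagonal entries `hᵢ` with the vector `(t₁, t₂, t₃)`. -/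
def weightAdjEntry (e₂ e₃ h₁ h₂ h₃ t₁ t₂ t₃ : ℝ) : ℝ :=
  (e₂ * e₃ - h₁ ^ 2) * t₁ + (e₃ * h₃ + h₁ * h₂) * t₂ + (e₂ * h₂ + h₃ * h₁) * t₃

/-- The determinant of the matrix with diagonal entries `-eᵢ` and off-diagonal entries `hᵢ`. -/
def weightDet (e₁ e₂ e₃ h₁ h₂ h₃ : ℝ) : ℝ :=
  -(e₁ * e₂ * e₃) + 2 * h₁ * h₂ * h₃ + e₁ * h₁ ^ 2 + e₂ * h₂ ^ 2 + e₃ * h₃ ^ 2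

section

variable {e₁ e₂ e₃ h₁ h₂ h₃ k₁ k₂ k₃ t₁ t₂ t₃ : ℝ}

/-- Cauchy–Schwarz for `(k, e)` and `(k', e')`, with `e² = e`, gives `t t' ≥ k k' + e e'`. -/
theorem one_lt_coshLength {e e' h k t k' t' : ℝ} (H : IsVertexScale e k t)
    (H' : IsVertexScale e' k' t') (hpos : 0 < e * e' + h) : 1 < coshLength h k t k' t' := by
  have hk := H.k_pos
  have hk' := H'.k_pos
  have ht := H.t_pos
  have ht' := H'.t_pos
  have h1 := H.sq_eq
  have h2 := H'.sq_eq
  rw [coshLength, one_lt_div (by positivity)]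
  have hsq : (k * k' + e * e') ^ 2 ≤ (t * t') ^ 2 := by
    rw [mul_pow t, h1, h2]
    rcases H.e_mem with rfl | rfl <;> rcases H'.e_mem with rfl | rfl <;>
      nlinarith [sq_nonneg (k - k'), sq_nonneg k, sq_nonneg k']
  have := abs_le_of_sq_le_sq' hsq (by positivity)
  linarith [this.2]

/-- The structure conditions make the last two summands of `weightAdjEntry` nonnegative, so the
coefficient of `t₁` must be nonpositive. -/
theorem pos_of_weightAdjEntry_nonpos (H : IsTriangleWeight e₁ e₂ e₃ h₁ h₂ h₃)
    (ht₁ : 0 < t₁) (ht₂ : 0 < t₂) (ht₃ : 0 < t₃)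
    (hg : weightAdjEntry e₂ e₃ h₁ h₂ h₃ t₁ t₂ t₃ ≤ 0) : e₂ * e₃ ≤ h₁ ^ 2 ∧ 0 < h₁ := by
  have h2 := mul_nonneg H.nonneg₃ ht₂.le
  have h3 := mul_nonneg H.nonneg₂ ht₃.le
  unfold weightAdjEntry at hg
  have h4 : e₂ * e₃ - h₁ ^ 2 ≤ 0 := by
    by_contra! h
    linarith [mul_pos h ht₁]
  refine ⟨by linarith, ?_⟩
  have h5 := H.pos₁
  rcases H.e₂_mem with rfl | rfl <;> rcases H.e₃_mem with rfl | rfl <;> nlinarith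

/-- At most one weight of the form can be nonpositive when the triangle is nondegenerate, which is
what `hf` expresses by `gramDet_coshLength`. -/
theorem not_weightAdjEntry_nonpos_pair (H : IsTriangleWeight e₁ e₂ e₃ h₁ h₂ h₃)
    (ht₁ : 0 < t₁) (ht₂ : 0 < t₂) (ht₃ : 0 < t₃)
    (hf : 0 < weightDet e₁ e₂ e₃ h₁ h₂ h₃ + t₁ * weightAdjEntry e₂ e₃ h₁ h₂ h₃ t₁ t₂ t₃ +
      t₂ * weightAdjEntry e₃ e₁ h₂ h₃ h₁ t₂ t₃ t₁ +
      t₃ * weightAdjEntry e₁ e₂ h₃ h₁ h₂ t₃ t₁ t₂)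
    (hg₁ : weightAdjEntry e₂ e₃ h₁ h₂ h₃ t₁ t₂ t₃ ≤ 0) :
    0 < weightAdjEntry e₃ e₁ h₂ h₃ h₁ t₂ t₃ t₁ := by
  by_contra! hg₂
  obtain ⟨ha₁, hh₁⟩ := pos_of_weightAdjEntry_nonpos H ht₁ ht₂ ht₃ hg₁
  obtain ⟨ha₂, hh₂⟩ := pos_of_weightAdjEntry_nonpos H.rotate ht₂ ht₃ ht₁ hg₂
  have n₁ := H.nonneg₁
  have n₂ := H.nonneg₂
  have n₃ := H.nonneg₃
  have he₁ : 0 ≤ e₁ := by rcases H.e₁_mem with h | h <;> simp [h]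
  have he₂ : 0 ≤ e₂ := by rcases H.e₂_mem with h | h <;> simp [h]
  rcases H.e₃_mem with h0 | h1
  · have key : h₂ * weightAdjEntry e₂ e₃ h₁ h₂ h₃ t₁ t₂ t₃ +
        h₁ * weightAdjEntry e₃ e₁ h₂ h₃ h₁ t₂ t₃ t₁ =
        (e₂ * h₂ ^ 2 + e₁ * h₁ ^ 2 + 2 * h₁ * h₂ * h₃) * t₃ := by
      subst h0; unfold weightAdjEntry; ring
    have hle : e₂ * h₂ ^ 2 + e₁ * h₁ ^ 2 + 2 * h₁ * h₂ * h₃ ≤ 0 := by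
      by_contra! h
      have := mul_pos h ht₃
      nlinarith [mul_nonneg hh₂.le (neg_nonneg.2 hg₁), mul_nonneg hh₁.le (neg_nonneg.2 hg₂)]
    have h12 := mul_pos hh₁ hh₂
    rcases lt_or_ge 0 h₃ with hh₃ | hh₃
    · have := mul_pos h12 hh₃
      nlinarith [mul_nonneg he₂ (sq_nonneg h₂), mul_nonneg he₁ (sq_nonneg h₁)]
    · have h5 := H.pos₃
      have e1 : e₁ = 1 := by
        rcases H.e₁_mem with rfl | h
        · linarith
        · exact h
      have e2 : e₂ = 1 := by
        rcases H.e₂_mem with rfl | h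
        · linarith
        · exact h
      subst e1 e2
      nlinarith [sq_nonneg (h₁ - h₂)]
  · subst h1
    have hdet : weightDet e₁ e₂ 1 h₁ h₂ h₃ ≤ 0 := by
      have u1 : (1 * h₃ + h₁ * h₂) * t₂ ≤ (h₁ ^ 2 - e₂ * 1) * t₁ := by
        have := mul_nonneg n₂ ht₃.le
        unfold weightAdjEntry at hg₁
        linarith
      have u2 : (1 * h₃ + h₁ * h₂) * t₁ ≤ (h₂ ^ 2 - 1 * e₁) * t₂ := by
        have := mul_nonneg n₁ ht₃.le
        unfold weightAdjEntry at hg₂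
        linarith
      -- The product of the two inequalities reads `(h₃ + h₁ h₂)² ≤ (h₁² - e₂)(h₂² - e₁)` after
      -- cancelling `t₁ t₂`; the two sides differ by `weightDet`.
      have u3 := mul_le_mul u1 u2 (by positivity) (mul_nonneg (by linarith) ht₁.le)
      have u4 : 0 ≤ (-weightDet e₁ e₂ 1 h₁ h₂ h₃) * (t₁ * t₂) := by
        unfold weightDet
        linear_combination u3
      linarith [nonneg_of_mul_nonneg_left u4 (mul_pos ht₁ ht₂)]
    have hh₃ : h₃ ≤ 0 := by
      by_contra! h
      have v1 := mul_pos (mul_pos hh₁ hh₂) h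
      have v2 := mul_nonneg he₁ (sub_nonneg.2 ha₁)
      have v3 := mul_nonneg he₂ (sq_nonneg h₂)
      unfold weightDet at hdet
      nlinarith [sq_nonneg h₃]
    -- One row of `W adj(W) t = det(W) t`. It makes the third entry nonpositive too, which
    -- contradicts `hf`.
    have row : h₂ * weightAdjEntry e₁ e₂ h₃ h₁ h₂ t₃ t₁ t₂ =
        weightDet e₁ e₂ 1 h₁ h₂ h₃ * t₁ + e₁ * weightAdjEntry e₂ 1 h₁ h₂ h₃ t₁ t₂ t₃ -
        h₃ * weightAdjEntry 1 e₁ h₂ h₃ h₁ t₂ t₃ t₁ := by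
      unfold weightAdjEntry weightDet; ring
    have hg₃ : weightAdjEntry e₁ e₂ h₃ h₁ h₂ t₃ t₁ t₂ ≤ 0 := by
      by_contra! h
      have := mul_pos hh₂ h
      have r1 := mul_nonneg (neg_nonneg.2 hdet) ht₁.le
      have r2 := mul_nonneg he₁ (neg_nonneg.2 hg₁)
      have r3 := mul_nonneg (neg_nonneg.2 hh₃) (neg_nonneg.2 hg₂)
      linarith
    linarith [mul_nonneg ht₁.le (neg_nonneg.2 hg₁), mul_nonneg ht₂.le (neg_nonneg.2 hg₂),
      mul_nonneg ht₃.le (neg_nonneg.2 hg₃)]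

/-- Up to positive factors, the determinant of the derivative of the edge lengths with respect to
the vertex coordinates. -/
def edgeDet (e₁ e₂ e₃ h₁ h₂ h₃ t₁ t₂ t₃ : ℝ) : ℝ :=
  (e₂ * t₃ + h₁ * t₂) * (e₃ * t₁ + h₂ * t₃) * (e₁ * t₂ + h₃ * t₁) +
    (e₃ * t₂ + h₁ * t₃) * (e₁ * t₃ + h₂ * t₁) * (e₂ * t₁ + h₃ * t₂)

theorem edgeDet_eq : edgeDet e₁ e₂ e₃ h₁ h₂ h₃ t₁ t₂ t₃ =
    2 * (t₁ * t₂ * t₃) * (e₁ * e₂ * e₃ + h₁ * h₂ * h₃) +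
    (e₁ * h₁ + h₂ * h₃) * t₁ * (e₃ * t₂ ^ 2 + e₂ * t₃ ^ 2) +
    (e₂ * h₂ + h₃ * h₁) * t₂ * (e₁ * t₃ ^ 2 + e₃ * t₁ ^ 2) +
    (e₃ * h₃ + h₁ * h₂) * t₃ * (e₂ * t₁ ^ 2 + e₁ * t₂ ^ 2) := by
  unfold edgeDet; ring

theorem edgeDet_nonneg_of_neg (H : IsTriangleWeight e₁ e₂ e₃ h₁ h₂ h₃)
    (ht₁ : 0 < t₁) (ht₂ : 0 < t₂) (ht₃ : 0 < t₃) (h3 : h₃ < 0) (h12 : 0 < h₁ * h₂) :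
    0 ≤ edgeDet e₁ e₂ e₃ h₁ h₂ h₃ t₁ t₂ t₃ := by
  have h5 := H.pos₃
  have e1 : e₁ = 1 := by
    rcases H.e₁_mem with rfl | h
    · linarith
    · exact h
  have e2 : e₂ = 1 := by
    rcases H.e₂_mem with rfl | h
    · linarith
    · exact h
  have he₃ : 0 ≤ e₃ := by rcases H.e₃_mem with h | h <;> simp [h]
  subst e1 e2
  have n₁ := mul_nonneg (mul_nonneg H.nonneg₁ ht₁.le)
    (show 0 ≤ e₃ * t₂ ^ 2 + 1 * t₃ ^ 2 by positivity)
  have n₂ := mul_nonneg (mul_nonneg H.nonneg₂ ht₂.le)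
    (show 0 ≤ 1 * t₃ ^ 2 + e₃ * t₁ ^ 2 by positivity)
  -- Replacing `t₁² + t₂²` by `(t₁ - t₂)²` frees a cross term, which joins the possibly negative
  -- first term of `edgeDet_eq` to form the product in `n₄`.
  have n₃ := mul_nonneg (mul_nonneg H.nonneg₃ ht₃.le) (sq_nonneg (t₁ - t₂))
  have n₄ : 0 ≤ 2 * (t₁ * t₂ * t₃) * ((e₃ + h₁ * h₂) * (1 + h₃)) :=
    mul_nonneg (by positivity) (mul_nonneg (by positivity) (by linarith))
  rw [edgeDet_eq]
  linarith

theorem edgeDet_nonneg (H : IsTriangleWeight e₁ e₂ e₃ h₁ h₂ h₃)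
    (ht₁ : 0 < t₁) (ht₂ : 0 < t₂) (ht₃ : 0 < t₃) :
    0 ≤ edgeDet e₁ e₂ e₃ h₁ h₂ h₃ t₁ t₂ t₃ := by
  have he₁ : 0 ≤ e₁ := by rcases H.e₁_mem with h | h <;> simp [h]
  have he₂ : 0 ≤ e₂ := by rcases H.e₂_mem with h | h <;> simp [h]
  have he₃ : 0 ≤ e₃ := by rcases H.e₃_mem with h | h <;> simp [h]
  have n₁ := H.nonneg₁
  have n₂ := H.nonneg₂
  have n₃ := H.nonneg₃
  rcases le_or_gt 0 (h₁ * h₂ * h₃) with h | h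
  · rw [edgeDet_eq]; positivity
  · rcases lt_or_ge h₃ 0 with h3 | h3
    · exact edgeDet_nonneg_of_neg H ht₁ ht₂ ht₃ h3 (pos_of_mul_neg_left h h3.le)
    · have h12 : h₁ * h₂ < 0 := by
        by_contra! h'
        linarith [mul_nonneg h' h3]
      have h3' : 0 < h₃ := lt_of_le_of_ne h3 (by rintro rfl; simp at h)
      rcases mul_neg_iff.1 h12 with ⟨h1, h2⟩ | ⟨h1, h2⟩
      · have := edgeDet_nonneg_of_neg H.rotate.rotate ht₃ ht₁ ht₂ h2 (mul_pos h3' h1)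
        unfold edgeDet at this ⊢
        linarith
      · have := edgeDet_nonneg_of_neg H.rotate ht₂ ht₃ ht₁ h1 (mul_pos h2 h3')
        unfold edgeDet at this ⊢
        linarith

theorem IsVertexScale.e_eq {e k t : ℝ} (H : IsVertexScale e k t) : e = t ^ 2 - k ^ 2 := by
  rw [H.sq_eq]; ring

/-- Scaling rows and columns of the Gram matrix by the `kᵢ` gives `W + t tᵀ`, where `W` has diagonal
`-eᵢ` and off-diagonal entries `hᵢ`. The identity is `adj(W + t tᵀ) t = adj(W) t`. -/
theorem adjEntry_coshLength
    (H₁ : IsVertexScale e₁ k₁ t₁) (H₂ : IsVertexScale e₂ k₂ t₂) (H₃ : IsVertexScale e₃ k₃ t₃) :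
    adjEntry (coshLength h₁ k₂ t₂ k₃ t₃) (coshLength h₂ k₃ t₃ k₁ t₁) (coshLength h₃ k₁ t₁ k₂ t₂)
      (t₁ / k₁) (t₂ / k₂) (t₃ / k₃) =
    weightAdjEntry e₂ e₃ h₁ h₂ h₃ t₁ t₂ t₃ * (k₁ / (k₁ * k₂ * k₃) ^ 2) := by
  have := H₁.k_pos
  have := H₂.k_pos
  have := H₃.k_pos
  rw [H₂.e_eq, H₃.e_eq]
  unfold adjEntry coshLength weightAdjEntry
  field_simp
  ring

/-- The matrix determinant lemma, `det(W + t tᵀ) = det W + tᵀ adj(W) t`. -/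
theorem gramDet_coshLength
    (H₁ : IsVertexScale e₁ k₁ t₁) (H₂ : IsVertexScale e₂ k₂ t₂) (H₃ : IsVertexScale e₃ k₃ t₃) :
    gramDet (coshLength h₁ k₂ t₂ k₃ t₃) (coshLength h₂ k₃ t₃ k₁ t₁) (coshLength h₃ k₁ t₁ k₂ t₂) =
    (weightDet e₁ e₂ e₃ h₁ h₂ h₃ + t₁ * weightAdjEntry e₂ e₃ h₁ h₂ h₃ t₁ t₂ t₃ +
      t₂ * weightAdjEntry e₃ e₁ h₂ h₃ h₁ t₂ t₃ t₁ +
      t₃ * weightAdjEntry e₁ e₂ h₃ h₁ h₂ t₃ t₁ t₂) / (k₁ * k₂ * k₃) ^ 2 := by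
  have := H₁.k_pos
  have := H₂.k_pos
  have := H₃.k_pos
  rw [H₁.e_eq, H₂.e_eq, H₃.e_eq]
  unfold gramDet coshLength weightAdjEntry weightDet
  field_simp
  ring

theorem coshLength_deriv_eq {e h k t k' t' : ℝ} (H : IsVertexScale e k t) (hk' : 0 < k') :
    t / k * coshLength h k t k' t' - t' / k' = (e * t' + h * t) / (k ^ 2 * k') := by
  have := H.k_pos
  rw [H.e_eq, coshLength]
  field_simp
  ring

theorem coshLength_comm {h k t k' t' : ℝ} : coshLength h k t k' t' = coshLength h k' t' k t := by
  unfold coshLength; ring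

/-- The quadratic form which, up to a negative factor, is the derivative of the angles of a
hyperbolic triangle with respect to the vertex coordinates. -/
noncomputable def angleForm (a b c u v w x y z : ℝ) : ℝ :=
  adjEntry a b c u v w / (a ^ 2 - 1) * (a * (y ^ 2 + z ^ 2) - 2 * y * z) +
    adjEntry b c a v w u / (b ^ 2 - 1) * (b * (z ^ 2 + x ^ 2) - 2 * z * x) +
    adjEntry c a b w u v / (c ^ 2 - 1) * (c * (x ^ 2 + y ^ 2) - 2 * x * y)

theorem angleForm_rotate {a b c u v w x y z : ℝ} :
    angleForm a b c u v w x y z = angleForm b c a v w u y z x := by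
  unfold angleForm; ring

theorem gramDet_rotate {a b c : ℝ} : gramDet a b c = gramDet b c a := by
  unfold gramDet; ring

theorem angleForm_nonneg_of_weightAdjEntry_neg
    (H₁ : IsVertexScale e₁ k₁ t₁) (H₂ : IsVertexScale e₂ k₂ t₂) (H₃ : IsVertexScale e₃ k₃ t₃)
    (H : IsTriangleWeight e₁ e₂ e₃ h₁ h₂ h₃)
    (hΔ : 0 < gramDet (coshLength h₁ k₂ t₂ k₃ t₃) (coshLength h₂ k₃ t₃ k₁ t₁)
      (coshLength h₃ k₁ t₁ k₂ t₂))
    (hg : weightAdjEntry e₂ e₃ h₁ h₂ h₃ t₁ t₂ t₃ < 0) (x y z : ℝ) :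
    0 ≤ angleForm (coshLength h₁ k₂ t₂ k₃ t₃) (coshLength h₂ k₃ t₃ k₁ t₁)
      (coshLength h₃ k₁ t₁ k₂ t₂) (t₁ / k₁) (t₂ / k₂) (t₃ / k₃) x y z := by
  have hk₁ := H₁.k_pos
  have hk₂ := H₂.k_pos
  have hk₃ := H₃.k_pos
  have ht₁ := H₁.t_pos
  have ht₂ := H₂.t_pos
  have ht₃ := H₃.t_pos
  have he₂ : 0 ≤ e₂ := by rcases H.e₂_mem with h | h <;> simp [h]
  have he₃ : 0 ≤ e₃ := by rcases H.e₃_mem with h | h <;> simp [h]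
  have hf := hΔ
  rw [gramDet_coshLength H₁ H₂ H₃] at hf
  have hf' := (div_pos_iff_of_pos_right (by positivity)).1 hf
  obtain ⟨-, hh₁⟩ := pos_of_weightAdjEntry_nonpos H ht₁ ht₂ ht₃ hg.le
  have hg₂ := not_weightAdjEntry_nonpos_pair H ht₁ ht₂ ht₃ hf' hg.le
  have hg₃ : 0 < weightAdjEntry e₁ e₂ h₃ h₁ h₂ t₃ t₁ t₂ := by
    by_contra! h
    refine absurd (not_weightAdjEntry_nonpos_pair H.rotate.rotate ht₃ ht₁ ht₂ ?_ h) hg.not_gt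
    unfold weightDet at hf' ⊢
    linarith
  apply sum_edgeForm_nonneg_of_neg (one_lt_coshLength H₂ H₃ H.pos₁)
    (one_lt_coshLength H₃ H₁ H.pos₂) (one_lt_coshLength H₁ H₂ H.pos₃) hΔ
  · rw [adjEntry_coshLength H₂ H₃ H₁]; positivity
  · rw [adjEntry_coshLength H₃ H₁ H₂]; positivity
  · rw [coshLength_deriv_eq H₂ hk₃]; positivity
  · rw [coshLength_comm, coshLength_deriv_eq H₃ hk₂]; positivity
  · rw [coshLength_deriv_eq H₂ hk₃, coshLength_deriv_eq H₃ hk₁, coshLength_deriv_eq H₁ hk₂,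
      coshLength_comm (h := h₁), coshLength_comm (h := h₂), coshLength_comm (h := h₃),
      coshLength_deriv_eq H₃ hk₂, coshLength_deriv_eq H₁ hk₃, coshLength_deriv_eq H₂ hk₁]
    have := edgeDet_nonneg H ht₁ ht₂ ht₃
    have h2 := div_nonneg this (show 0 ≤ (k₁ * k₂ * k₃) ^ 3 by positivity)
    refine h2.trans_eq ?_
    unfold edgeDet
    field_simp

theorem angleForm_nonneg
    (H₁ : IsVertexScale e₁ k₁ t₁) (H₂ : IsVertexScale e₂ k₂ t₂) (H₃ : IsVertexScale e₃ k₃ t₃)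
    (H : IsTriangleWeight e₁ e₂ e₃ h₁ h₂ h₃)
    (hΔ : 0 < gramDet (coshLength h₁ k₂ t₂ k₃ t₃) (coshLength h₂ k₃ t₃ k₁ t₁)
      (coshLength h₃ k₁ t₁ k₂ t₂)) (x y z : ℝ) :
    0 ≤ angleForm (coshLength h₁ k₂ t₂ k₃ t₃) (coshLength h₂ k₃ t₃ k₁ t₁)
      (coshLength h₃ k₁ t₁ k₂ t₂) (t₁ / k₁) (t₂ / k₂) (t₃ / k₃) x y z := by
  by_cases hg₁ : weightAdjEntry e₂ e₃ h₁ h₂ h₃ t₁ t₂ t₃ < 0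
  · exact angleForm_nonneg_of_weightAdjEntry_neg H₁ H₂ H₃ H hΔ hg₁ x y z
  by_cases hg₂ : weightAdjEntry e₃ e₁ h₂ h₃ h₁ t₂ t₃ t₁ < 0
  · rw [angleForm_rotate]
    rw [gramDet_rotate] at hΔ
    exact angleForm_nonneg_of_weightAdjEntry_neg H₂ H₃ H₁ H.rotate hΔ hg₂ _ _ _
  by_cases hg₃ : weightAdjEntry e₁ e₂ h₃ h₁ h₂ t₃ t₁ t₂ < 0
  · rw [angleForm_rotate, angleForm_rotate]
    rw [gramDet_rotate, gramDet_rotate] at hΔ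
    exact angleForm_nonneg_of_weightAdjEntry_neg H₃ H₁ H₂ H.rotate.rotate hΔ hg₃ _ _ _
  have hk₁ := H₁.k_pos
  have hk₂ := H₂.k_pos
  have hk₃ := H₃.k_pos
  have c₁ := one_lt_coshLength H₂ H₃ H.pos₁
  have c₂ := one_lt_coshLength H₃ H₁ H.pos₂
  have c₃ := one_lt_coshLength H₁ H₂ H.pos₃
  have aux : ∀ a g r y z : ℝ, 1 < a → ¬ g < 0 → 0 < r →
      0 ≤ g * r / (a ^ 2 - 1) * (a * (y ^ 2 + z ^ 2) - 2 * y * z) := by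
    intro a g r y z ha hg hr
    exact mul_nonneg (div_nonneg (mul_nonneg (not_lt.1 hg) hr.le) (by nlinarith))
      (edgeForm_nonneg ha y z)
  unfold angleForm
  rw [adjEntry_coshLength H₁ H₂ H₃, adjEntry_coshLength H₂ H₃ H₁, adjEntry_coshLength H₃ H₁ H₂]
  exact add_nonneg (add_nonneg (aux _ _ _ _ _ c₁ hg₁ (by positivity))
    (aux _ _ _ _ _ c₂ hg₂ (by positivity))) (aux _ _ _ _ _ c₃ hg₃ (by positivity))

end

/-! ### The extended angle and its derivative. -/

open Set Filter Topology

/-- The angle opposite to the side of length `x` in terms of the hyperbolic cosines of the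
lengths of the sides. -/
noncomputable def coshAngle (a b c : ℝ) : ℝ :=
  Real.arccos ((b * c - a) / (√(b ^ 2 - 1) * √(c ^ 2 - 1)))

/-- `Real.arccos` equals `π` below `-1` and `0` above `1`, so the law of cosines already yields the
degenerate values. This makes continuity of the extension immediate. -/
theorem extendedAngle_eq_hyperbolicAngle {x y z : ℝ} (hx : 0 < x) (hy : 0 < y) (hz : 0 < z) :
    extendedAngle x y z = hyperbolicAngle x y z := by
  have hs : 0 < Real.sinh y * Real.sinh z :=
    mul_pos (Real.sinh_pos_iff.2 hy) (Real.sinh_pos_iff.2 hz)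
  unfold extendedAngle
  split_ifs with h1 h2
  · rfl
  · unfold hyperbolicAngle
    rw [Real.arccos_of_le_neg_one]
    rw [div_le_iff₀ hs]
    have : Real.cosh (y + z) ≤ Real.cosh x := by
      rw [Real.cosh_le_cosh, abs_of_pos hx, abs_of_pos (by linarith)]; exact h2
    rw [Real.cosh_add] at this
    linarith
  · unfold hyperbolicAngle
    rw [Real.arccos_of_one_le]
    rw [le_div_iff₀ hs]
    have : Real.cosh x ≤ Real.cosh (y - z) := by
      rw [Real.cosh_le_cosh, abs_of_pos hx, le_abs]
      by_contra! h
      exact h1 ⟨by linarith, by linarith, by linarith⟩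
    rw [Real.cosh_sub] at this
    linarith

theorem extendedAngle_arcosh {a b c : ℝ} (ha : 1 < a) (hb : 1 < b) (hc : 1 < c) :
    extendedAngle (Real.arcosh a) (Real.arcosh b) (Real.arcosh c) = coshAngle a b c := by
  rw [extendedAngle_eq_hyperbolicAngle (Real.arcosh_pos ha) (Real.arcosh_pos hb)
    (Real.arcosh_pos hc), hyperbolicAngle, coshAngle, Real.cosh_arcosh ha.le,
    Real.cosh_arcosh hb.le, Real.cosh_arcosh hc.le, Real.sinh_arcosh hb.le, Real.sinh_arcosh hc.le]

theorem sqrt_sq_sub_one_pos {b : ℝ} (hb : 1 < b) : 0 < √(b ^ 2 - 1) :=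
  Real.sqrt_pos.2 (by nlinarith)

/-- The difference `(b² - 1)(c² - 1) - (b c - a)²` is `gramDet a b c`, so the argument of `arccos`
has absolute value at least `1`. -/
theorem coshAngle_mem_of_gramDet_nonpos {a b c : ℝ} (hb : 1 < b) (hc : 1 < c)
    (hΔ : gramDet a b c ≤ 0) : coshAngle a b c = 0 ∨ coshAngle a b c = Real.pi := by
  have h1 := sqrt_sq_sub_one_pos hb
  have h2 := sqrt_sq_sub_one_pos hc
  have hsq : (√(b ^ 2 - 1) * √(c ^ 2 - 1)) ^ 2 ≤ (b * c - a) ^ 2 := by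
    rw [mul_pow, Real.sq_sqrt (by nlinarith), Real.sq_sqrt (by nlinarith)]
    unfold gramDet at hΔ
    linarith
  have := sq_le_sq.1 hsq
  rw [abs_of_pos (mul_pos h1 h2), le_abs] at this
  rcases this with h | h
  · left
    exact Real.arccos_of_one_le ((one_le_div (mul_pos h1 h2)).2 h)
  · right
    apply Real.arccos_of_le_neg_one
    rw [div_le_iff₀ (mul_pos h1 h2)]
    linarith

/-- The sine of the angle is `√gramDet` over the product of the adjacent hyperbolic sines. As
`gramDet` is symmetric, the same prefactor serves all three angles. -/
theorem hasDerivAt_coshAngle {a b c : ℝ → ℝ} {a' b' c' s : ℝ} (hb : 1 < b s) (hc : 1 < c s)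
    (hΔ : 0 < gramDet (a s) (b s) (c s)) (ha' : HasDerivAt a a' s) (hb' : HasDerivAt b b' s)
    (hc' : HasDerivAt c c' s) :
    HasDerivAt (fun s => coshAngle (a s) (b s) (c s))
      ((√(gramDet (a s) (b s) (c s)))⁻¹ * (a' - b' * (a s * b s - c s) / (b s ^ 2 - 1) -
        c' * (a s * c s - b s) / (c s ^ 2 - 1))) s := by
  set B := √(b s ^ 2 - 1) with hB
  set C := √(c s ^ 2 - 1) with hC
  have hBpos : 0 < B := sqrt_sq_sub_one_pos hb
  have hCpos : 0 < C := sqrt_sq_sub_one_pos hc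
  have hB1 : 0 < b s ^ 2 - 1 := by nlinarith
  have hC1 : 0 < c s ^ 2 - 1 := by nlinarith
  have hBsq : B ^ 2 = b s ^ 2 - 1 := Real.sq_sqrt hB1.le
  have hCsq : C ^ 2 = c s ^ 2 - 1 := Real.sq_sqrt hC1.le
  set D := √(gramDet (a s) (b s) (c s)) with hD
  have hDpos : 0 < D := Real.sqrt_pos.2 hΔ
  have hDsq : D ^ 2 = gramDet (a s) (b s) (c s) := Real.sq_sqrt hΔ.le
  have hr : 1 - ((b s * c s - a s) / (B * C)) ^ 2 = (D / (B * C)) ^ 2 := by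
    rw [div_pow, div_pow, hDsq, mul_pow, hBsq, hCsq]
    field_simp
    unfold gramDet
    ring
  have hrpos : 0 < (D / (B * C)) ^ 2 := by positivity
  have hBd : HasDerivAt (fun s => √(b s ^ 2 - 1)) (b s * b' / B) s := by
    have := ((hb'.pow 2).sub_const 1).sqrt hB1.ne'
    refine this.congr_deriv ?_
    simp only [Pi.pow_apply, ← hB]
    field_simp
    ring
  have hCd : HasDerivAt (fun s => √(c s ^ 2 - 1)) (c s * c' / C) s := by
    have := ((hc'.pow 2).sub_const 1).sqrt hC1.ne'
    refine this.congr_deriv ?_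
    simp only [Pi.pow_apply, ← hC]
    field_simp
    ring
  have hd := ((hb'.mul hc').sub ha').div (hBd.mul hCd) (mul_pos hBpos hCpos).ne'
  have harc := (Real.hasDerivAt_arccos (x := (b s * c s - a s) / (B * C))
    (by intro h; rw [h] at hr; norm_num at hr; rw [← hr] at hrpos; exact lt_irrefl _ hrpos)
    (by intro h; rw [h] at hr; norm_num at hr; rw [← hr] at hrpos; exact lt_irrefl _ hrpos))
  have := harc.comp s hd
  refine this.congr_deriv ?_
  rw [hr, Real.sqrt_sq (by positivity)]
  simp only [Pi.mul_apply, Pi.sub_apply, ← hB, ← hC]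
  rw [← hBsq, ← hCsq]
  have e1 : b s ^ 2 = B ^ 2 + 1 := by rw [hBsq]; ring
  have e2 : c s ^ 2 = C ^ 2 + 1 := by rw [hCsq]; ring
  field_simp
  ring_nf
  simp only [e1, e2]
  ring

/-- A continuous function on `[0, 1]` whose derivative is nonpositive wherever its value lies
outside a finite set does not increase. -/
theorem le_of_hasDerivAt_nonpos_or_mem_finite {φ : ℝ → ℝ} {E : Set ℝ} (hE : E.Finite)
    (hφ : ContinuousOn φ (Icc 0 1))
    (h : ∀ s ∈ Ioo (0 : ℝ) 1, φ s ∈ E ∨ ∃ d ≤ 0, HasDerivAt φ d s) : φ 1 ≤ φ 0 := by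
  by_contra! hlt
  -- Take a level `c` between `φ 0` and `φ 1` outside `E`, and let `s` be the last time with `φ s ≤
  -- c`. Just after `s` the values still avoid `E`, so `φ` cannot rise above `c`.
  obtain ⟨c, hc, hcE⟩ := ((Ioo_infinite hlt).sdiff hE).nonempty
  have hcomp : IsCompact (Icc (0 : ℝ) 1 ∩ φ ⁻¹' Iic c) :=
    isCompact_Icc.of_isClosed_subset (hφ.preimage_isClosed_of_isClosed isClosed_Icc isClosed_Iic)
      inter_subset_left
  obtain ⟨s, ⟨hs, hsc⟩, hmax⟩ := hcomp.exists_isGreatest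
    ⟨0, ⟨left_mem_Icc.2 zero_le_one, hc.1.le⟩⟩
  have hs1 : s < 1 := lt_of_le_of_ne hs.2 (by rintro rfl; exact absurd hsc hc.2.not_ge)
  have hgt : ∀ x ∈ Ioc s 1, c < φ x := by
    intro x hx
    by_contra! hxc
    exact absurd (hmax ⟨⟨hs.1.trans hx.1.le, hx.2⟩, hxc⟩) hx.1.not_ge
  have hcs : ContinuousWithinAt φ (Ioc s 1) s :=
    (hφ s hs).mono (fun x hx => ⟨hs.1.trans hx.1.le, hx.2⟩)
  have hval : φ s = c := by
    refine le_antisymm hsc ?_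
    have : (𝓝[Ioc s 1] s).NeBot := by
      rw [← mem_closure_iff_nhdsWithin_neBot, closure_Ioc hs1.ne]
      exact left_mem_Icc.2 hs1.le
    exact ge_of_tendsto hcs (eventually_nhdsWithin_of_forall fun x hx => (hgt x hx).le)
  have hev : ∀ᶠ x in 𝓝[Ioc s 1] s, φ x ∈ Eᶜ :=
    hcs.eventually (hE.isClosed.isOpen_compl.mem_nhds (by rw [hval]; exact hcE))
  rw [nhdsWithin_Ioc_eq_nhdsGT hs1] at hev
  obtain ⟨b, hb, hbE⟩ := (mem_nhdsGT_iff_exists_Ioo_subset).1 hev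
  set r := min b 1 with hr
  have hsr : s < r := lt_min hb hs1
  have hr1 : r ≤ 1 := min_le_right _ _
  have hanti : AntitoneOn φ (Icc s r) := by
    have hd : ∀ x ∈ interior (Icc s r), ∃ d ≤ 0, HasDerivAt φ d x := by
      intro x hx
      rw [interior_Icc] at hx
      exact (h x ⟨hs.1.trans_lt hx.1, hx.2.trans_le hr1⟩).resolve_left
        (hbE ⟨hx.1, hx.2.trans_le (min_le_left _ _)⟩)
    refine antitoneOn_of_deriv_nonpos (convex_Icc _ _)
      (hφ.mono (Icc_subset_Icc hs.1 hr1)) ?_ ?_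
    · intro x hx
      obtain ⟨d, -, hd⟩ := hd x hx
      exact hd.differentiableAt.differentiableWithinAt
    · intro x hx
      obtain ⟨d, hd0, hd⟩ := hd x hx
      rw [hd.deriv]; exact hd0
  have := hanti (left_mem_Icc.2 hsr.le) (right_mem_Icc.2 hsr.le) hsr.le
  linarith [hgt r ⟨hsr, hr1⟩]

/-! ### Coordinates at the vertices. -/

/-- The range of the coordinate `u` at a vertex of weight `e`. -/
def coordDomain (e : ℝ) : Set ℝ := {u | e = 0 ∨ u < 0}

/-- `e^{-f}` as a function of the coordinate `u`. -/
noncomputable def vertexK (e u : ℝ) : ℝ := if e = 0 then Real.exp (-u) else -Real.sinh u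

/-- `√(e^{-2f} + e)` as a function of the coordinate `u`. -/
noncomputable def vertexT (e u : ℝ) : ℝ := if e = 0 then Real.exp (-u) else Real.cosh u

theorem isOpen_coordDomain (e : ℝ) : IsOpen (coordDomain e) := by
  by_cases h : e = 0
  · simp [coordDomain, h]
  · simpa [coordDomain, h] using! (isOpen_Iio : IsOpen (Iio (0 : ℝ)))

theorem convex_coordDomain (e : ℝ) : Convex ℝ (coordDomain e) := by
  by_cases h : e = 0
  · simpa [coordDomain, h] using convex_univ
  · simpa [coordDomain, h] using! convex_Iio (0 : ℝ)

theorem isVertexScale_vertexK {e u : ℝ} (he : e = 0 ∨ e = 1) (hu : u ∈ coordDomain e) :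
    IsVertexScale e (vertexK e u) (vertexT e u) := by
  rcases he with rfl | rfl
  · exact ⟨.inl rfl, by simp [vertexK, Real.exp_pos], by simp [vertexT, Real.exp_pos],
      by simp [vertexK, vertexT]⟩
  · have hu' : u < 0 := by simpa [coordDomain] using hu
    refine ⟨.inr rfl, by simpa [vertexK] using hu', by simp [vertexT, Real.cosh_pos], ?_⟩
    simp only [vertexT, vertexK, one_ne_zero, if_false, Real.cosh_sq]
    ring

theorem hasDerivAt_vertexK (e u : ℝ) : HasDerivAt (vertexK e) (-vertexT e u) u := by
  unfold vertexK vertexT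
  split_ifs
  · simpa using (hasDerivAt_neg u).exp
  · exact (Real.hasDerivAt_sinh u).neg

theorem hasDerivAt_vertexT {e u : ℝ} : HasDerivAt (vertexT e) (-vertexK e u) u := by
  unfold vertexK vertexT
  split_ifs
  · simpa using (hasDerivAt_neg u).exp
  · simpa using Real.hasDerivAt_cosh u

theorem continuous_vertexK (e : ℝ) : Continuous (vertexK e) :=
  continuous_iff_continuousAt.2 fun u => (hasDerivAt_vertexK e u).continuousAt

theorem continuous_vertexT (e : ℝ) : Continuous (vertexT e) :=
  continuous_iff_continuousAt.2 fun _ => hasDerivAt_vertexT.continuousAt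

theorem vertexK_injective (e : ℝ) : Function.Injective (vertexK e) := by
  intro u v h
  unfold vertexK at h
  split_ifs at h
  · simpa using h
  · simpa using h

theorem uCoord_mem_coordDomain_and_vertexK_uCoord {e : ℝ} (he : e = 0 ∨ e = 1) (f : ℝ) :
    uCoord e f ∈ coordDomain e ∧ vertexK e (uCoord e f) = Real.exp (-f) := by
  rcases he with rfl | rfl
  · simp [coordDomain, uCoord, vertexK]
  · set a := Real.exp f with ha
    have ha0 : 0 < a := Real.exp_pos f
    set w := √(1 + a ^ 2) with hw
    have hwsq : w ^ 2 = 1 + a ^ 2 := Real.sq_sqrt (by positivity)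
    have hw0 : 0 ≤ w := Real.sqrt_nonneg _
    have hlt : a < w + 1 := by nlinarith
    have hu : uCoord 1 f = Real.log (a / (w + 1)) := by
      have h2 : Real.exp (2 * f) = a ^ 2 := by rw [ha, ← Real.exp_nat_mul]; norm_num
      -- From `w² - 1 = a²`; hence `u = log (a / (w + 1))` and `-sinh u = 1 / a`.
      have h3 : (w - 1) / (w + 1) = (a / (w + 1)) ^ 2 := by
        field_simp
        nlinarith
      rw [uCoord, if_neg one_ne_zero, one_mul, h2, ← hw, h3, abs_of_nonneg (sq_nonneg _),
        Real.log_pow]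
      push_cast
      ring
    have hq : 0 < a / (w + 1) := by positivity
    rw [hu]
    constructor
    · exact .inr (Real.log_neg hq ((div_lt_one (by positivity)).2 hlt))
    · rw [vertexK, if_neg one_ne_zero, Real.sinh_eq, Real.exp_neg, Real.exp_log hq, Real.exp_neg,
        ← ha]
      field_simp
      nlinarith

theorem uCoord_mem_coordDomain {e : ℝ} (he : e = 0 ∨ e = 1) (f : ℝ) :
    uCoord e f ∈ coordDomain e := (uCoord_mem_coordDomain_and_vertexK_uCoord he f).1

theorem vertexK_uCoord {e : ℝ} (he : e = 0 ∨ e = 1) (f : ℝ) :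
    vertexK e (uCoord e f) = Real.exp (-f) := (uCoord_mem_coordDomain_and_vertexK_uCoord he f).2

theorem uCoord_injective {e : ℝ} (he : e = 0 ∨ e = 1) : Function.Injective (uCoord e) := by
  intro f g h
  have := congrArg (vertexK e) h
  rw [vertexK_uCoord he, vertexK_uCoord he] at this
  simpa using this

theorem uCoord_neg_log_vertexK {e u : ℝ} (he : e = 0 ∨ e = 1) (hu : u ∈ coordDomain e) :
    uCoord e (-Real.log (vertexK e u)) = u := by
  apply vertexK_injective e
  rw [vertexK_uCoord he, neg_neg, Real.exp_log (isVertexScale_vertexK he hu).k_pos]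

theorem one_add_mul_exp_eq {e f t : ℝ} (H : IsVertexScale e (Real.exp (-f)) t) :
    1 + e * Real.exp (2 * f) = (t / Real.exp (-f)) ^ 2 := by
  have h : Real.exp (2 * f) = (Real.exp (-f) ^ 2)⁻¹ := by
    rw [← Real.exp_nat_mul, ← Real.exp_neg]; norm_num
  have := Real.exp_pos (-f)
  rw [div_pow, H.sq_eq, h]
  field_simp

theorem sqrt_add_eq_coshLength {e e' f f' h t t' : ℝ} (H : IsVertexScale e (Real.exp (-f)) t)
    (H' : IsVertexScale e' (Real.exp (-f')) t') :
    √((1 + e * Real.exp (2 * f)) * (1 + e' * Real.exp (2 * f'))) + h * Real.exp (f + f') =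
      coshLength h (Real.exp (-f)) t (Real.exp (-f')) t' := by
  have h1 := Real.exp_pos (-f)
  have h2 := Real.exp_pos (-f')
  have h3 := H.t_pos
  have h4 := H'.t_pos
  have h5 : Real.exp (f + f') = (Real.exp (-f) * Real.exp (-f'))⁻¹ := by
    rw [← Real.exp_add, ← Real.exp_neg]; ring_nf
  rw [one_add_mul_exp_eq H, one_add_mul_exp_eq H', ← mul_pow, Real.sqrt_sq (by positivity), h5,
    coshLength]
  field_simp

theorem hasDerivAt_coshLength {h y z s : ℝ} {k t k' t' : ℝ → ℝ} (hk : k s ≠ 0) (hk' : k' s ≠ 0)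
    (dk : HasDerivAt k (-t s * y) s) (dt : HasDerivAt t (-k s * y) s)
    (dk' : HasDerivAt k' (-t' s * z) s) (dt' : HasDerivAt t' (-k' s * z) s) :
    HasDerivAt (fun s => coshLength h (k s) (t s) (k' s) (t' s))
      ((t s / k s * coshLength h (k s) (t s) (k' s) (t' s) - t' s / k' s) * y +
        (t' s / k' s * coshLength h (k s) (t s) (k' s) (t' s) - t s / k s) * z) s := by
  have := ((dt.mul dt').add_const h).div (dk.mul dk') (mul_ne_zero hk hk')
  refine this.congr_deriv ?_
  simp only [Pi.mul_apply, coshLength]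
  field_simp
  ring

/-! ### Monotonicity of the angles of one triangle. -/

/-- The hyperbolic cosine of the length of the side opposite to the corner `a` of a triangle, as a
function of the coordinates of its corners. -/
noncomputable def sideCosh (e h u : Fin 3 → ℝ) (a : Fin 3) : ℝ :=
  coshLength (h a) (vertexK (e (a + 1)) (u (a + 1))) (vertexT (e (a + 1)) (u (a + 1)))
    (vertexK (e (a + 2)) (u (a + 2))) (vertexT (e (a + 2)) (u (a + 2)))

/-- The extended inner angle at the corner `a` of a triangle, as a function of the coordinates of
its corners. -/
noncomputable def coordAngle (e h u : Fin 3 → ℝ) (a : Fin 3) : ℝ :=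
  coshAngle (sideCosh e h u a) (sideCosh e h u (a + 1)) (sideCosh e h u (a + 2))

theorem one_lt_sideCosh {e h u : Fin 3 → ℝ} (he : ∀ a, e a = 0 ∨ e a = 1)
    (hh : ∀ a, 0 < e (a + 1) * e (a + 2) + h a) (hu : ∀ a, u a ∈ coordDomain (e a)) (a : Fin 3) :
    1 < sideCosh e h u a :=
  one_lt_coshLength (isVertexScale_vertexK (he _) (hu _)) (isVertexScale_vertexK (he _) (hu _))
    (hh a)

theorem continuousAt_sideCosh {e h u : Fin 3 → ℝ} (he : ∀ a, e a = 0 ∨ e a = 1)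
    (hu : ∀ a, u a ∈ coordDomain (e a)) (a : Fin 3) :
    ContinuousAt (fun u => sideCosh e h u a) u := by
  unfold sideCosh coshLength
  have hK : ∀ b, ContinuousAt (fun u : Fin 3 → ℝ => vertexK (e b) (u b)) u := fun b =>
    ((continuous_vertexK _).comp (continuous_apply b)).continuousAt
  have hT : ∀ b, ContinuousAt (fun u : Fin 3 → ℝ => vertexT (e b) (u b)) u := fun b =>
    ((continuous_vertexT _).comp (continuous_apply b)).continuousAt
  exact (((hT _).mul (hT _)).add continuousAt_const).div ((hK _).mul (hK _))
    (mul_pos (isVertexScale_vertexK (he _) (hu _)).k_pos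
      (isVertexScale_vertexK (he _) (hu _)).k_pos).ne'

theorem continuousAt_coordAngle {e h u : Fin 3 → ℝ} (he : ∀ a, e a = 0 ∨ e a = 1)
    (hh : ∀ a, 0 < e (a + 1) * e (a + 2) + h a) (hu : ∀ a, u a ∈ coordDomain (e a)) (a : Fin 3) :
    ContinuousAt (fun u => coordAngle e h u a) u := by
  unfold coordAngle coshAngle
  have hc := fun b => continuousAt_sideCosh (h := h) he hu b
  refine Real.continuous_arccos.continuousAt.comp ?_
  refine (((hc _).mul (hc _)).sub (hc _)).div
    ((((hc _).pow 2).sub continuousAt_const).sqrt.mul (((hc _).pow 2).sub continuousAt_const).sqrt)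
    (mul_pos (sqrt_sq_sub_one_pos (one_lt_sideCosh he hh hu _))
      (sqrt_sq_sub_one_pos (one_lt_sideCosh he hh hu _))).ne'

/-- The angles of a triangle depend monotonically on the coordinates of its corners. -/
theorem sum_mul_coordAngle_sub_nonpos {e h u v : Fin 3 → ℝ} (he : ∀ a, e a = 0 ∨ e a = 1)
    (hh : ∀ a, 0 < e (a + 1) * e (a + 2) + h a)
    (hn : ∀ a, 0 ≤ e a * h a + h (a + 1) * h (a + 2))
    (hu : ∀ a, u a ∈ coordDomain (e a)) (hv : ∀ a, v a ∈ coordDomain (e a)) :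
    ∑ a, (u a - v a) * (coordAngle e h u a - coordAngle e h v a) ≤ 0 := by
  set δ : Fin 3 → ℝ := fun a => u a - v a with hδ
  set ℓ : ℝ → Fin 3 → ℝ := fun s a => v a + s * δ a with hℓ
  have hmem : ∀ s ∈ Icc (0 : ℝ) 1, ∀ a, ℓ s a ∈ coordDomain (e a) := by
    intro s hs a
    have := (convex_coordDomain (e a)).add_smul_sub_mem (hv a) (hu a) hs
    simpa using this
  have hℓc : Continuous ℓ := by
    simp only [hℓ]; fun_prop
  set φ : ℝ → ℝ := fun s => ∑ a, δ a * coordAngle e h (ℓ s) a with hφ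
  have hφc : ContinuousOn φ (Icc 0 1) := by
    intro s hs
    refine ContinuousAt.continuousWithinAt ?_
    refine tendsto_finsetSum _ fun a _ => ?_
    exact continuousAt_const.mul
      (ContinuousAt.comp (f := ℓ) (continuousAt_coordAngle he hh (hmem s hs) a) hℓc.continuousAt)
  have hW : IsTriangleWeight (e 0) (e 1) (e 2) (h 0) (h 1) (h 2) :=
    ⟨he 0, he 1, he 2, hh 0, hh 1, hh 2, hn 0, hn 1, hn 2⟩
  -- The possible values of the pairing when all three angles lie in `{0, π}`.
  have hfin : ((fun p : Fin 3 → ℝ => ∑ a, δ a * p a) ''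
      (Set.pi univ fun _ => ({0, Real.pi} : Set ℝ))).Finite :=
    (Set.Finite.pi fun _ => by simp).image _
  have hle : φ 1 ≤ φ 0 := by
    refine le_of_hasDerivAt_nonpos_or_mem_finite hfin hφc fun s hs => ?_
    have hs' := hmem s (Ioo_subset_Icc_self hs)
    have hS : ∀ a, IsVertexScale (e a) (vertexK (e a) (ℓ s a)) (vertexT (e a) (ℓ s a)) := fun a =>
      isVertexScale_vertexK (he a) (hs' a)
    have hC := one_lt_sideCosh he hh hs'
    have hrot : ∀ a : Fin 3, gramDet (sideCosh e h (ℓ s) a) (sideCosh e h (ℓ s) (a + 1))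
        (sideCosh e h (ℓ s) (a + 2)) = gramDet (sideCosh e h (ℓ s) 0) (sideCosh e h (ℓ s) 1)
        (sideCosh e h (ℓ s) 2) := by
      intro a
      fin_cases a
      · rfl
      · exact gramDet_rotate.symm
      · exact gramDet_rotate
    rcases le_or_gt (gramDet (sideCosh e h (ℓ s) 0) (sideCosh e h (ℓ s) 1)
      (sideCosh e h (ℓ s) 2)) 0 with hΔ | hΔ
    · left
      refine ⟨fun a => coordAngle e h (ℓ s) a, fun a _ => ?_, rfl⟩
      exact coshAngle_mem_of_gramDet_nonpos (hC _) (hC _) ((hrot a).trans_le hΔ)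
    · right
      set K : Fin 3 → ℝ := fun a => vertexK (e a) (ℓ s a)
      set T : Fin 3 → ℝ := fun a => vertexT (e a) (ℓ s a)
      set C : Fin 3 → ℝ := sideCosh e h (ℓ s) with hCdef
      have dℓ : ∀ a, HasDerivAt (fun s => ℓ s a) (δ a) s := fun a =>
        (hasDerivAt_mul_const (δ a)).const_add (v a)
      have dK : ∀ a, HasDerivAt (fun s => vertexK (e a) (ℓ s a)) (-T a * δ a) s := fun a =>
        HasDerivAt.comp (h₂ := vertexK (e a)) s (hasDerivAt_vertexK (e a) (ℓ s a)) (dℓ a)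
      have dT : ∀ a, HasDerivAt (fun s => vertexT (e a) (ℓ s a)) (-K a * δ a) s := fun a =>
        HasDerivAt.comp (h₂ := vertexT (e a)) s hasDerivAt_vertexT (dℓ a)
      set D : Fin 3 → ℝ := fun a =>
        (T (a + 1) / K (a + 1) * C a - T (a + 2) / K (a + 2)) * δ (a + 1) +
          (T (a + 2) / K (a + 2) * C a - T (a + 1) / K (a + 1)) * δ (a + 2) with hD
      have dC : ∀ a, HasDerivAt (fun s => sideCosh e h (ℓ s) a) (D a) s := fun a =>
        hasDerivAt_coshLength (h := h a) (hS (a + 1)).k_pos.ne' (hS (a + 2)).k_pos.ne'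
          (dK (a + 1)) (dT (a + 1)) (dK (a + 2)) (dT (a + 2))
      have dA : ∀ a, HasDerivAt (fun s => coordAngle e h (ℓ s) a)
          ((√(gramDet (C 0) (C 1) (C 2)))⁻¹ *
            (D a - D (a + 1) * (C a * C (a + 1) - C (a + 2)) / (C (a + 1) ^ 2 - 1) -
              D (a + 2) * (C a * C (a + 2) - C (a + 1)) / (C (a + 2) ^ 2 - 1))) s := fun a => by
        rw [← hrot a] at hΔ ⊢
        exact hasDerivAt_coshAngle (hC (a + 1)) (hC (a + 2)) hΔ (dC a) (dC (a + 1)) (dC (a + 2))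
      have dφ := HasDerivAt.fun_sum (u := Finset.univ) fun a _ => (dA a).const_mul (δ a)
      refine ⟨_, ?_, dφ⟩
      have hform : 0 ≤ angleForm (C 0) (C 1) (C 2) (T 0 / K 0) (T 1 / K 1) (T 2 / K 2)
        (δ 0) (δ 1) (δ 2) := angleForm_nonneg (hS 0) (hS 1) (hS 2) hW hΔ (δ 0) (δ 1) (δ 2)
      have hq : ∀ a, C a ^ 2 - 1 ≠ 0 := fun a => by nlinarith [hC a]
      have heq := adjEntry_quotient_form (T 0 / K 0) (T 1 / K 1) (T 2 / K 2) (δ 0) (δ 1) (δ 2)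
        (hq 0) (hq 1) (hq 2) (da := D 0) (db := D 1) (dc := D 2) rfl rfl rfl
      have hpos : 0 ≤ (√(gramDet (C 0) (C 1) (C 2)))⁻¹ := by positivity
      have hprod := mul_nonneg hpos hform
      clear_value D C K T
      rw [Fin.sum_univ_three]
      have i1 : (0 : Fin 3) + 1 = 1 := rfl
      have i2 : (0 : Fin 3) + 2 = 2 := rfl
      have i3 : (1 : Fin 3) + 1 = 2 := rfl
      have i4 : (1 : Fin 3) + 2 = 0 := rfl
      have i5 : (2 : Fin 3) + 1 = 0 := rfl
      have i6 : (2 : Fin 3) + 2 = 1 := rfl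
      rw [i1, i2, i3, i4, i5, i6]
      refine le_trans (le_of_eq ?_) (neg_nonpos.2 hprod)
      unfold angleForm
      rw [← mul_neg, ← heq]
      ring
  have h1 : φ 1 = ∑ a, δ a * coordAngle e h u a := by
    have : ℓ 1 = u := by ext a; simp [hℓ, hδ]
    simp only [hφ, this]
  have h0 : φ 0 = ∑ a, δ a * coordAngle e h v a := by
    have : ℓ 0 = v := by ext a; simp [hℓ]
    simp only [hφ, this]
  rw [h1, h0] at hle
  simp only [mul_sub, Finset.sum_sub_distrib]
  linarith

/-! ### Integral curves of continuous monotone fields. -/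

/-- A continuous vector field on a ball has approximate integral curves which start at the centre
of the ball and remain in it, on a time interval that does not depend on the error. -/
theorem exists_approx_integralCurve {E : Type*} [NormedAddCommGroup E] [NormedSpace ℝ E]
    [FiniteDimensional ℝ E] {F : E → E} (hF : Continuous F) {x₀ : E} {r M T η : ℝ} (hr : 0 ≤ r)
    (hT : 0 ≤ T) (hM : ∀ x ∈ Metric.closedBall x₀ r, ‖F x‖ ≤ M) (hMT : (M + η) * T ≤ r)
    (hη : 0 < η) :
    ∃ α d : ℝ → E, α 0 = x₀ ∧ ∀ t ∈ Icc 0 T, α t ∈ Metric.closedBall x₀ r ∧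
      HasDerivWithinAt α (d t) (Icc 0 T) t ∧ ‖d t - F (α t)‖ ≤ η := by
  have : CompleteSpace E := FiniteDimensional.complete ℝ E
  obtain ⟨G, hG, hGF, -⟩ := hF.exists_contDiff_approx 1 (continuous_const (y := η)) fun _ => hη
  have hGF' : ∀ x, ‖G x - F x‖ ≤ η := fun x => by rw [← dist_eq_norm]; exact (hGF x).le
  have hM0 : 0 ≤ M := (norm_nonneg _).trans (hM x₀ (Metric.mem_closedBall_self hr))
  obtain ⟨K, hK⟩ := hG.contDiffOn.exists_lipschitzOnWith (by simp) (convex_closedBall x₀ r)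
    (isCompact_closedBall x₀ r)
  lift r to NNReal using hr
  obtain ⟨L, hL⟩ : ∃ L : NNReal, (L : ℝ) = M + η := ⟨⟨M + η, by positivity⟩, rfl⟩
  have hP : IsPicardLindelof (fun _ => G) (⟨0, left_mem_Icc.2 hT⟩ : Icc (0 : ℝ) T) x₀
      r 0 L K := by
    refine IsPicardLindelof.of_time_independent (fun x hx => ?_) hK ?_
    · have := norm_add_le (F x) (G x - F x)
      rw [add_sub_cancel] at this
      rw [hL]
      exact this.trans (add_le_add (hM x hx) (hGF' x))
    · simpa [hT, hL] using hMT
  have hx : x₀ ∈ Metric.closedBall x₀ ((0 : NNReal) : ℝ) := by simp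
  -- Working with the fixed point itself keeps the curve in the ball, by the Lipschitz bound built
  -- into `FunSpace`.
  obtain ⟨α, hα⟩ := ODE.FunSpace.exists_isFixedPt_next hP hx
  have hmem : ∀ t, α.compProj t ∈ Metric.closedBall x₀ r := fun t =>
    α.compProj_mem_closedBall hP.mul_max_le
  refine ⟨α.compProj, fun t => G (α.compProj t), ?_, fun t ht => ⟨hmem t, ?_, hGF' _⟩⟩
  · have := ODE.FunSpace.compProj_val (α := α) (t := ⟨0, left_mem_Icc.2 hT⟩)
    rw [this, ← hα, ODE.FunSpace.next_apply₀]
  · apply (ODE.hasDerivWithinAt_picard_Icc (left_mem_Icc.2 hT) hP.continuousOn_uncurry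
      α.continuous_compProj.continuousOn (fun _ _ => hmem _) x₀ ht).congr_of_mem _ ht
    intro t' ht'
    nth_rw 1 [← hα]
    rw [ODE.FunSpace.compProj_of_mem ht', ODE.FunSpace.next_apply]

/-- A uniform limit of differentiable curves on `[0, T]` whose derivatives converge uniformly is
differentiable on `[0, T)`. -/
theorem hasDerivWithinAt_Ico_of_tendstoUniformlyOn {E : Type*} [NormedAddCommGroup E]
    [NormedSpace ℝ E] {α d : ℕ → ℝ → E} {u g : ℝ → E} {T : ℝ}
    (hα : TendstoUniformlyOn α u atTop (Icc 0 T)) (hd : TendstoUniformlyOn d g atTop (Icc 0 T))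
    (hαd : ∀ n, ∀ t ∈ Icc 0 T, HasDerivWithinAt (α n) (d n t) (Icc 0 T) t)
    (hg : ContinuousOn g (Icc 0 T)) {t : ℝ} (ht : t ∈ Ico 0 T) :
    HasDerivWithinAt u (g t) (Ico 0 T) t := by
  have hT : 0 < T := ht.1.trans_lt ht.2
  have hu : ContinuousOn u (Icc 0 T) := hα.continuousOn <|
    Frequently.of_forall fun n t ht => (hαd n t ht).continuousWithinAt
  have hin : ∀ x ∈ Ioo 0 T, HasDerivAt u (g x) x := fun x hx =>
    hasDerivAt_of_tendstoUniformlyOn isOpen_Ioo (hd.mono Ioo_subset_Icc_self)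
      (Eventually.of_forall fun n y hy =>
        (hαd n y (Ioo_subset_Icc_self hy)).hasDerivAt (Icc_mem_nhds hy.1 hy.2))
      (fun y hy => hα.tendsto_at (Ioo_subset_Icc_self hy)) hx
  -- At the left endpoint the one-sided derivative is recovered as the limit of the interior
  -- derivatives.
  rcases ht.1.eq_or_lt with rfl | h0
  · refine (hasDerivWithinAt_Ici_of_tendsto_deriv (s := Ioo 0 T)
      (fun x hx => (hin x hx).differentiableAt.differentiableWithinAt) ?_
      (Ioo_mem_nhdsGT hT) ?_).mono Ico_subset_Ici_self
    · exact (hu 0 (left_mem_Icc.2 hT.le)).mono Ioo_subset_Icc_self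
    · have h1 : Tendsto g (𝓝[>] 0) (𝓝 (g 0)) := by
        rw [← nhdsWithin_Ioo_eq_nhdsGT hT]
        exact (hg 0 (left_mem_Icc.2 hT.le)).mono Ioo_subset_Icc_self
      refine h1.congr' ?_
      filter_upwards [Ioo_mem_nhdsGT hT] with x hx
      exact (hin x hx).deriv.symm
  · exact (hin t ⟨h0, ht.2⟩).hasDerivWithinAt

theorem hasDerivWithinAt_sum_sub_sq {V : Type*} [Fintype V] {x y : ℝ → V → ℝ} {x' y' : V → ℝ}
    {s : Set ℝ} {t : ℝ} (hx : ∀ v, HasDerivWithinAt (fun t => x t v) (x' v) s t)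
    (hy : ∀ v, HasDerivWithinAt (fun t => y t v) (y' v) s t) :
    HasDerivWithinAt (fun t => ∑ v, (x t v - y t v) ^ 2)
      (2 * ∑ v, (x t v - y t v) * (x' v - y' v)) s t := by
  have := HasDerivWithinAt.fun_sum (u := Finset.univ) fun v _ => ((hx v).sub (hy v)).pow 2
  refine this.congr_deriv ?_
  rw [Finset.mul_sum]
  refine Finset.sum_congr rfl fun v _ => ?_
  simp
  ring

/-- Two approximate integral curves of a monotone vector field remain close. -/
theorem sum_sub_sq_le_of_approx {V : Type*} [Fintype V] {F : (V → ℝ) → V → ℝ} {B : Set (V → ℝ)}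
    (hmono : ∀ x ∈ B, ∀ y ∈ B, ∑ v, (x v - y v) * (F x v - F y v) ≤ 0) {R : ℝ}
    (hB : ∀ x ∈ B, ∀ y ∈ B, ‖x - y‖ ≤ R) {x y x' y' : ℝ → V → ℝ} {T a b : ℝ}
    (h0 : x 0 = y 0)
    (hx : ∀ t ∈ Icc 0 T, x t ∈ B ∧ HasDerivWithinAt x (x' t) (Icc 0 T) t ∧ ‖x' t - F (x t)‖ ≤ a)
    (hy : ∀ t ∈ Icc 0 T, y t ∈ B ∧ HasDerivWithinAt y (y' t) (Icc 0 T) t ∧ ‖y' t - F (y t)‖ ≤ b)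
    {t : ℝ} (ht : t ∈ Icc 0 T) :
    ∑ v, (x t v - y t v) ^ 2 ≤ 2 * (Fintype.card V * (R * (a + b))) * T := by
  have hd : ∀ s ∈ Icc 0 T, HasDerivWithinAt (fun t => ∑ v, (x t v - y t v) ^ 2)
      (2 * ∑ v, (x s v - y s v) * (x' s v - y' s v)) (Icc 0 T) s := fun s hs =>
    hasDerivWithinAt_sum_sub_sq (hasDerivWithinAt_pi.1 (hx s hs).2.1)
      (hasDerivWithinAt_pi.1 (hy s hs).2.1)
  have hbound : ∀ s ∈ Icc 0 T, 2 * ∑ v, (x s v - y s v) * (x' s v - y' s v) ≤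
      2 * (Fintype.card V * (R * (a + b))) := by
    intro s hs
    obtain ⟨hxB, -, hxa⟩ := hx s hs
    obtain ⟨hyB, -, hyb⟩ := hy s hs
    have hR := hB _ hxB _ hyB
    -- Removing the field differences, whose pairing is nonpositive by `hmono`, leaves only the
    -- approximation errors.
    have hsum : ∑ v, ((x s v - y s v) * (x' s v - y' s v) -
        (x s v - y s v) * (F (x s) v - F (y s) v)) ≤ ∑ _v : V, R * (a + b) := by
      refine Finset.sum_le_sum fun v _ => ?_
      have e1 : |x s v - y s v| ≤ R := (norm_le_pi_norm (x s - y s) v).trans hR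
      have e2 : |x' s v - F (x s) v| ≤ a := (norm_le_pi_norm (x' s - F (x s)) v).trans hxa
      have e3 : |y' s v - F (y s) v| ≤ b := (norm_le_pi_norm (y' s - F (y s)) v).trans hyb
      rw [← mul_sub]
      refine (le_abs_self _).trans ?_
      rw [abs_mul]
      refine mul_le_mul e1 ?_ (abs_nonneg _) ((abs_nonneg _).trans e1)
      have : x' s v - y' s v - (F (x s) v - F (y s) v) =
        (x' s v - F (x s) v) - (y' s v - F (y s) v) := by ring
      rw [this]
      exact (abs_sub _ _).trans (add_le_add e2 e3)
    rw [Finset.sum_sub_distrib, Finset.sum_const, Finset.card_univ, nsmul_eq_mul] at hsum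
    linarith [hmono _ hxB _ hyB]
  have hT : 0 ≤ T := ht.1.trans ht.2
  have := Convex.image_sub_le_mul_sub_of_deriv_le (convex_Icc 0 T)
    (f := fun t => ∑ v, (x t v - y t v) ^ 2) (C := 2 * (Fintype.card V * (R * (a + b))))
    (fun s hs => (hd s hs).continuousWithinAt)
    (fun s hs => ((hd s (interior_subset hs)).differentiableWithinAt).mono interior_subset)
    (fun s hs => by
      have hs' := hs
      rw [interior_Icc] at hs'
      rw [((hd s (interior_subset hs)).hasDerivAt (Icc_mem_nhds hs'.1 hs'.2)).deriv]
      exact hbound s (interior_subset hs))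
    0 (left_mem_Icc.2 hT) t ht ht.1
  have hnn : 0 ≤ 2 * (Fintype.card V * (R * (a + b))) := by
    obtain ⟨hxB, -, hxa⟩ := hx t ht
    obtain ⟨hyB, -, hyb⟩ := hy t ht
    have h1 := (norm_nonneg _).trans (hB _ hxB _ hyB)
    have h2 := (norm_nonneg _).trans hxa
    have h3 := (norm_nonneg _).trans hyb
    positivity
  simp only [h0, sub_self, sub_zero] at this
  norm_num at this
  nlinarith [mul_le_mul_of_nonneg_left ht.2 hnn]

/-- Local existence of integral curves, forward in time, for a continuous vector field which is
monotone (nonincreasing). -/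
theorem exists_integralCurve_of_monotone {V : Type*} [Fintype V] {U : Set (V → ℝ)}
    (hU : IsOpen U) {F : (V → ℝ) → V → ℝ} (hF : ContinuousOn F U)
    (hmono : ∀ x ∈ U, ∀ y ∈ U, ∑ v, (x v - y v) * (F x v - F y v) ≤ 0) {x₀ : V → ℝ}
    (hx₀ : x₀ ∈ U) :
    ∃ T > 0, ∃ u : ℝ → V → ℝ, u 0 = x₀ ∧ ∀ t ∈ Ico 0 T, u t ∈ U ∧
      HasDerivWithinAt u (F (u t)) (Ico 0 T) t := by
  obtain ⟨r, hr, hrU⟩ := Metric.nhds_basis_closedBall.mem_iff.1 (hU.mem_nhds hx₀)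
  set B := Metric.closedBall x₀ r with hBdef
  have hBc : IsCompact B := isCompact_closedBall x₀ r
  have hFB : ContinuousOn F B := hF.mono hrU
  -- Tietze extension: the smoothing step needs a field that is continuous on the whole space.
  obtain ⟨G, hG⟩ := ContinuousMap.exists_restrict_eq Metric.isClosed_closedBall
    (⟨B.domRestrict F, hFB.domRestrict⟩ : C(B, V → ℝ))
  have hGF : ∀ x ∈ B, G x = F x := fun x hx => DFunLike.congr_fun hG ⟨x, hx⟩
  obtain ⟨M, hM⟩ := hBc.exists_bound_of_continuousOn hFB
  have hM0 : 0 ≤ M := (norm_nonneg _).trans (hM x₀ (Metric.mem_closedBall_self hr.le))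
  -- All errors `1 / (n + 1)` are at most `1`, so this one time serves every approximation.
  set T := r / (M + 1) with hTdef
  have hT : 0 < T := by positivity
  have happrox : ∀ n : ℕ, ∃ α d : ℝ → V → ℝ, α 0 = x₀ ∧ ∀ t ∈ Icc 0 T, α t ∈ B ∧
      HasDerivWithinAt α (d t) (Icc 0 T) t ∧ ‖d t - F (α t)‖ ≤ 1 / ((n : ℝ) + 1) := by
    intro n
    have hn : 0 < 1 / ((n : ℝ) + 1) := by positivity
    have hn1 : 1 / ((n : ℝ) + 1) ≤ 1 := by
      rw [div_le_one (by positivity)]; linarith [Nat.cast_nonneg (α := ℝ) n]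
    obtain ⟨α, d, h0, h⟩ := exists_approx_integralCurve (x₀ := x₀) G.continuous hr.le hT.le
      (fun x hx => (hGF x hx).symm ▸ hM x hx)
      (show (M + 1 / ((n : ℝ) + 1)) * T ≤ r by
        calc (M + 1 / ((n : ℝ) + 1)) * T ≤ (M + 1) * T := by gcongr
          _ = r := by rw [hTdef]; field_simp) hn
    refine ⟨α, d, h0, fun t ht => ?_⟩
    obtain ⟨h1, h2, h3⟩ := h t ht
    exact ⟨h1, h2, hGF _ h1 ▸ h3⟩
  choose α d hα0 hα using happrox
  have hclose : ∀ n m : ℕ, ∀ t ∈ Icc 0 T, ∑ v, (α n t v - α m t v) ^ 2 ≤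
      2 * (Fintype.card V * (2 * r * (1 / ((n : ℝ) + 1) + 1 / ((m : ℝ) + 1)))) * T :=
    fun n m t ht => sum_sub_sq_le_of_approx
      (fun x hx y hy => hmono x (hrU hx) y (hrU hy))
      (fun x hx y hy => by
        rw [← dist_eq_norm]
        have h1 := dist_triangle_right x y x₀
        have h2 := Metric.mem_closedBall.1 hx
        have h3 := Metric.mem_closedBall.1 hy
        linarith)
      ((hα0 n).trans (hα0 m).symm) (hα n) (hα m) ht
  have hcauchy : UniformCauchySeqOn α atTop (Icc 0 T) := by
    rw [Metric.uniformCauchySeqOn_iff]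
    intro ε hε
    have hlim : Tendsto (fun n : ℕ => 2 * (Fintype.card V * (2 * r * (1 / ((n : ℝ) + 1) +
        1 / ((n : ℝ) + 1)))) * T) atTop (𝓝 (2 * (Fintype.card V * (2 * r * (0 + 0))) * T)) :=
      (((((tendsto_one_div_add_atTop_nhds_zero_nat (𝕜 := ℝ)).add
        tendsto_one_div_add_atTop_nhds_zero_nat).const_mul (2 * r)).const_mul _).const_mul
          2).mul_const T
    obtain ⟨N, hN⟩ := (hlim.eventually_lt_const (u := ε ^ 2) (by simp; positivity)).exists
    refine ⟨N, fun m hm n hn t ht => ?_⟩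
    have hle : ∑ v, (α m t v - α n t v) ^ 2 < ε ^ 2 := by
      refine (hclose m n t ht).trans_lt (lt_of_le_of_lt ?_ hN)
      gcongr
    rw [dist_pi_lt_iff hε]
    intro v
    rw [Real.dist_eq]
    refine abs_lt_of_sq_lt_sq (lt_of_le_of_lt ?_ hle) hε.le
    exact Finset.single_le_sum (f := fun v => (α m t v - α n t v) ^ 2)
      (fun _ _ => sq_nonneg _) (Finset.mem_univ v)
  have hpt : ∀ t, ∃ x, t ∈ Icc 0 T → Tendsto (fun n => α n t) atTop (𝓝 x) := by
    intro t
    by_cases ht : t ∈ Icc 0 T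
    · obtain ⟨x, hx⟩ := cauchySeq_tendsto_of_complete (hcauchy.cauchySeq ht)
      exact ⟨x, fun _ => hx⟩
    · exact ⟨0, fun h => absurd h ht⟩
  choose u hu using hpt
  have hαu : TendstoUniformlyOn α u atTop (Icc 0 T) :=
    hcauchy.tendstoUniformlyOn_of_tendsto fun t ht => hu t ht
  have huB : ∀ t ∈ Icc 0 T, u t ∈ B := fun t ht =>
    Metric.isClosed_closedBall.mem_of_tendsto (hu t ht) (Eventually.of_forall fun n => (hα n t ht).1)
  have huc : ContinuousOn u (Icc 0 T) := hαu.continuousOn <|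
    Frequently.of_forall fun n t ht => (hα n t ht).2.1.continuousWithinAt
  have hFu : TendstoUniformlyOn (fun n t => F (α n t)) (fun t => F (u t)) atTop (Icc 0 T) := by
    have hFuc := Metric.uniformContinuousOn_iff.1 (hBc.uniformContinuousOn_of_continuous hFB)
    rw [Metric.tendstoUniformlyOn_iff] at hαu ⊢
    intro ε hε
    obtain ⟨δ, hδ, hFδ⟩ := hFuc ε hε
    filter_upwards [hαu δ hδ] with n hn t ht
    exact hFδ _ (huB t ht) _ (hα n t ht).1 (hn t ht)
  have hdu : TendstoUniformlyOn d (fun t => F (u t)) atTop (Icc 0 T) := by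
    rw [Metric.tendstoUniformlyOn_iff] at hFu ⊢
    intro ε hε
    have hn := (tendsto_one_div_add_atTop_nhds_zero_nat (𝕜 := ℝ)).eventually_lt_const (half_pos hε)
    filter_upwards [hFu (ε / 2) (half_pos hε), hn] with n h1 h2 t ht
    have h3 := (hα n t ht).2.2
    rw [← dist_eq_norm, dist_comm] at h3
    linarith [dist_triangle (F (u t)) (F (α n t)) (d n t), h1 t ht]
  refine ⟨T, hT, u, ?_, fun t ht => ⟨hrU (huB t (Ico_subset_Icc_self ht)), ?_⟩⟩
  · refine tendsto_nhds_unique (hu 0 (left_mem_Icc.2 hT.le)) ?_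
    simp only [hα0]
    exact tendsto_const_nhds
  · exact hasDerivWithinAt_Ico_of_tendstoUniformlyOn hαu hdu (fun n t ht => (hα n t ht).2.1)
      (hFB.comp huc huB) ht

/-! ### The flow on the surface. -/

namespace TriangulatedSurface

variable {F : Type*} {S : TriangulatedSurface F}

/-- The corner weights of a triangle. -/
def cornerWeight (ε : S.Vertex → ℝ) (t : F) (a : Fin 3) : ℝ := ε (S.vertexAt t a)

/-- The side weights of a triangle. -/
def sideWeight (η : S.Edge → ℝ) (t : F) (a : Fin 3) : ℝ := η (S.edgeOf (oppositeSide t a))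

/-- The extended curvature at `v` as a function of the coordinates `u`. -/
noncomputable def coordCurvature [Fintype F] (ε : S.Vertex → ℝ) (η : S.Edge → ℝ)
    (u : S.Vertex → ℝ) (v : S.Vertex) : ℝ :=
  2 * Real.pi - ∑ t : F, ∑ a : Fin 3, open Classical in
    if S.vertexAt t a = v then
      coordAngle (cornerWeight ε t) (sideWeight η t) (fun b => u (S.vertexAt t b)) a else 0

/-- The vectors which are coordinates of generalized hyperbolic discrete conformal factors. -/
def coordRegion (ε : S.Vertex → ℝ) : Set (S.Vertex → ℝ) := {u | ∀ v, u v ∈ coordDomain (ε v)}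

instance [Finite F] : Finite S.Vertex := Quot.finite _

theorem isOpen_coordRegion [Finite F] (ε : S.Vertex → ℝ) : IsOpen (coordRegion ε) := by
  have : coordRegion ε = Set.pi univ fun v => coordDomain (ε v) := by
    ext; simp [coordRegion]
  rw [this]
  exact isOpen_set_pi finite_univ fun v _ => isOpen_coordDomain _

theorem StructureCondition₁.cornerWeight_pos {ε : S.Vertex → ℝ} {η : S.Edge → ℝ}
    (h₁ : S.StructureCondition₁ ε η) (t : F) (a : Fin 3) :
    0 < cornerWeight ε t (a + 1) * cornerWeight ε t (a + 2) + sideWeight η t a :=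
  h₁ (oppositeSide t a)

theorem cornerAngle_eq_coordAngle {ε : S.Vertex → ℝ} (hε : ∀ v, ε v = 0 ∨ ε v = 1)
    {η : S.Edge → ℝ} (h₁ : S.StructureCondition₁ ε η) (f : S.Vertex → ℝ) (t : F) (a : Fin 3) :
    S.cornerAngle ε η f t a = coordAngle (cornerWeight ε t) (sideWeight η t)
      (fun b => uCoord (ε (S.vertexAt t b)) (f (S.vertexAt t b))) a := by
  have hlen : ∀ b, S.sideLength ε η f (oppositeSide t b) =
      Real.arcosh (sideCosh (cornerWeight ε t) (sideWeight η t)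
        (fun b => uCoord (ε (S.vertexAt t b)) (f (S.vertexAt t b))) b) := by
    intro b
    have hs : ∀ v, IsVertexScale (ε v) (Real.exp (-f v)) (vertexT (ε v) (uCoord (ε v) (f v))) := by
      intro v
      rw [← vertexK_uCoord (hε v)]
      exact isVertexScale_vertexK (hε v) (uCoord_mem_coordDomain (hε v) _)
    have := sqrt_add_eq_coshLength (h := sideWeight η t b) (hs (S.vertexAt t (b + 1)))
      (hs (S.vertexAt t (b + 2)))
    rw [← vertexK_uCoord (hε _), ← vertexK_uCoord (hε _)] at this
    exact congrArg Real.arcosh this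
  have hC := one_lt_sideCosh (e := cornerWeight ε t) (h := sideWeight η t)
    (u := fun b => uCoord (ε (S.vertexAt t b)) (f (S.vertexAt t b))) (fun _ => hε _)
    (fun _ => h₁.cornerWeight_pos t _) (fun _ => uCoord_mem_coordDomain (hε _) _)
  rw [cornerAngle, hlen, hlen, hlen, extendedAngle_arcosh (hC _) (hC _) (hC _)]
  rfl

theorem extendedCurvature_eq_coordCurvature [Fintype F] {ε : S.Vertex → ℝ}
    (hε : ∀ v, ε v = 0 ∨ ε v = 1) {η : S.Edge → ℝ} (h₁ : S.StructureCondition₁ ε η)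
    (f : S.Vertex → ℝ) (v : S.Vertex) :
    S.extendedCurvature ε η f v = coordCurvature ε η (fun v => uCoord (ε v) (f v)) v := by
  unfold extendedCurvature coordCurvature
  simp only [cornerAngle_eq_coordAngle hε h₁]

theorem continuousOn_coordCurvature [Fintype F] {ε : S.Vertex → ℝ}
    (hε : ∀ v, ε v = 0 ∨ ε v = 1) {η : S.Edge → ℝ} (h₁ : S.StructureCondition₁ ε η) :
    ContinuousOn (coordCurvature ε η) (coordRegion ε) := by
  intro u hu
  refine ContinuousAt.continuousWithinAt (continuousAt_pi.2 fun v => ?_)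
  refine continuousAt_const.sub (tendsto_finsetSum _ fun t _ => tendsto_finsetSum _ fun a _ => ?_)
  split_ifs
  · exact ContinuousAt.comp (f := fun (u : S.Vertex → ℝ) b => u (S.vertexAt t b))
      (continuousAt_coordAngle (fun _ => hε _) (fun _ => h₁.cornerWeight_pos t _)
        (fun _ => hu _) a) (continuous_pi fun b => continuous_apply _).continuousAt
  · exact tendsto_const_nhds

/-- The curvature depends monotonically on the coordinates. -/
theorem sum_mul_coordCurvature_sub_nonneg [Fintype F] [Fintype S.Vertex] {ε : S.Vertex → ℝ}
    (hε : ∀ v, ε v = 0 ∨ ε v = 1) {η : S.Edge → ℝ} (h₁ : S.StructureCondition₁ ε η)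
    (h₂ : S.StructureCondition₂ ε η) {x y : S.Vertex → ℝ} (hx : x ∈ coordRegion ε)
    (hy : y ∈ coordRegion ε) :
    0 ≤ ∑ v, (x v - y v) * (coordCurvature ε η x v - coordCurvature ε η y v) := by
  classical
  -- Exchanging the sums over vertices and corners splits the pairing into contributions of single
  -- triangles.
  have key : ∑ v, (x v - y v) * (coordCurvature ε η x v - coordCurvature ε η y v) =
      -∑ t : F, ∑ a, (x (S.vertexAt t a) - y (S.vertexAt t a)) *
        (coordAngle (cornerWeight ε t) (sideWeight η t) (fun b => x (S.vertexAt t b)) a -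
          coordAngle (cornerWeight ε t) (sideWeight η t) (fun b => y (S.vertexAt t b)) a) := by
    have : ∀ v, (x v - y v) * (coordCurvature ε η x v - coordCurvature ε η y v) =
        -∑ t : F, ∑ a, if S.vertexAt t a = v then (x (S.vertexAt t a) - y (S.vertexAt t a)) *
          (coordAngle (cornerWeight ε t) (sideWeight η t) (fun b => x (S.vertexAt t b)) a -
            coordAngle (cornerWeight ε t) (sideWeight η t) (fun b => y (S.vertexAt t b)) a)
          else 0 := by
      intro v
      rw [coordCurvature, coordCurvature, sub_sub_sub_cancel_left, ← neg_sub (∑ t : F, _), mul_neg,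
        ← Finset.sum_sub_distrib, Finset.mul_sum]
      congr 1
      refine Finset.sum_congr rfl fun t _ => ?_
      rw [← Finset.sum_sub_distrib, Finset.mul_sum]
      refine Finset.sum_congr rfl fun a _ => ?_
      split_ifs with h
      · rw [h]
      · simp
    simp only [this]
    rw [Finset.sum_neg_distrib, Finset.sum_comm]
    congr 1
    refine Finset.sum_congr rfl fun t _ => ?_
    rw [Finset.sum_comm]
    refine Finset.sum_congr rfl fun a _ => ?_
    simp
  rw [key, neg_nonneg]
  refine Finset.sum_nonpos fun t _ => ?_
  exact sum_mul_coordAngle_sub_nonpos (fun _ => hε _) (fun _ => h₁.cornerWeight_pos t _)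
    (fun a => h₂ t a) (fun _ => hx _) (fun _ => hy _)

theorem ordConnected_timeInterval (T : EReal) : (timeInterval T).OrdConnected :=
  ⟨fun _ hx _ hy _ hz => ⟨hx.1.trans hz.1, (EReal.coe_le_coe_iff.2 hz.2).trans_lt hy.2⟩⟩

theorem timeInterval_coe (T : ℝ) : timeInterval (T : EReal) = Ico 0 T := by
  ext t
  simp [timeInterval]

/-- The equation is solved for `u` inside `coordRegion`, and `f` is recovered from `e^{-f} =
vertexK`. -/
theorem exists_isExtendedRicciFlow [Fintype F] {ε : S.Vertex → ℝ}
    (hε : ∀ v, ε v = 0 ∨ ε v = 1) {η : S.Edge → ℝ} (h₁ : S.StructureCondition₁ ε η)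
    (h₂ : S.StructureCondition₂ ε η) (Kbar f₀ : S.Vertex → ℝ) :
    ∃ T : EReal, 0 < T ∧ ∃ f : ℝ → S.Vertex → ℝ, S.IsExtendedRicciFlow ε η Kbar f₀ T f := by
  have := Fintype.ofFinite S.Vertex
  obtain ⟨T, hT, u, hu0, hu⟩ := exists_integralCurve_of_monotone (isOpen_coordRegion ε)
    (F := fun u v => Kbar v - coordCurvature ε η u v)
    (x₀ := fun v => uCoord (ε v) (f₀ v))
    (continuousOn_const.sub (continuousOn_coordCurvature hε h₁))
    (fun x hx y hy => by
      have := sum_mul_coordCurvature_sub_nonneg hε h₁ h₂ hx hy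
      rw [← neg_nonneg, ← Finset.sum_neg_distrib]
      refine this.trans_eq (Finset.sum_congr rfl fun v _ => ?_)
      ring)
    (fun v => uCoord_mem_coordDomain (hε v) _)
  have hfu : ∀ t ∈ Ico 0 T, ∀ v, uCoord (ε v) (-Real.log (vertexK (ε v) (u t v))) = u t v :=
    fun t ht v => uCoord_neg_log_vertexK (hε v) ((hu t ht).1 v)
  refine ⟨T, EReal.coe_pos.2 hT, fun t v => -Real.log (vertexK (ε v) (u t v)), ?_, ?_⟩
  · ext v
    apply uCoord_injective (hε v)
    rw [hfu 0 (left_mem_Ico.2 hT), hu0]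
  · rw [timeInterval_coe]
    intro t ht v
    rw [extendedCurvature_eq_coordCurvature hε h₁]
    simp only [hfu t ht]
    exact (hasDerivWithinAt_pi.1 (hu t ht).2 v).congr (fun s hs => hfu s hs v) (hfu t ht v)

/-- The squared distance in `u` starts at zero and is nonincreasing; injectivity of `uCoord` carries
the equality back to `f`. -/
theorem IsExtendedRicciFlow.eqOn [Fintype F] {ε : S.Vertex → ℝ}
    (hε : ∀ v, ε v = 0 ∨ ε v = 1) {η : S.Edge → ℝ} (h₁ : S.StructureCondition₁ ε η)
    (h₂ : S.StructureCondition₂ ε η) {Kbar f₀ : S.Vertex → ℝ} {T : EReal}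
    {f g : ℝ → S.Vertex → ℝ} (hf : S.IsExtendedRicciFlow ε η Kbar f₀ T f)
    (hg : S.IsExtendedRicciFlow ε η Kbar f₀ T g) : EqOn f g (timeInterval T) := by
  have := Fintype.ofFinite S.Vertex
  intro t ht
  set x : ℝ → S.Vertex → ℝ := fun s v => uCoord (ε v) (f s v) with hx
  set y : ℝ → S.Vertex → ℝ := fun s v => uCoord (ε v) (g s v) with hy
  have hd : ∀ s ∈ timeInterval T, HasDerivWithinAt (fun s => ∑ v, (x s v - y s v) ^ 2)
      (2 * ∑ v, (x s v - y s v) * ((Kbar v - coordCurvature ε η (x s) v) -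
        (Kbar v - coordCurvature ε η (y s) v))) (timeInterval T) s := by
    intro s hs
    refine hasDerivWithinAt_sum_sub_sq (fun v => ?_) (fun v => ?_)
    · rw [hx, ← extendedCurvature_eq_coordCurvature hε h₁]; exact hf.2 s hs v
    · rw [hy, ← extendedCurvature_eq_coordCurvature hε h₁]; exact hg.2 s hs v
  have hanti : AntitoneOn (fun s => ∑ v, (x s v - y s v) ^ 2) (timeInterval T) := by
    refine antitoneOn_of_hasDerivWithinAt_nonpos (ordConnected_timeInterval T).convex
      (fun s hs => (hd s hs).continuousWithinAt)
      (fun s hs => (hd s (interior_subset hs)).mono interior_subset) fun s hs => ?_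
    have := sum_mul_coordCurvature_sub_nonneg hε h₁ h₂ (x := x s) (y := y s)
      (fun v => uCoord_mem_coordDomain (hε v) _) (fun v => uCoord_mem_coordDomain (hε v) _)
    have heq : ∑ v, (x s v - y s v) * ((Kbar v - coordCurvature ε η (x s) v) -
        (Kbar v - coordCurvature ε η (y s) v)) = -∑ v, (x s v - y s v) *
        (coordCurvature ε η (x s) v - coordCurvature ε η (y s) v) := by
      rw [← Finset.sum_neg_distrib]
      exact Finset.sum_congr rfl fun v _ => by ring
    rw [heq]
    linarith
  have h0 : (0 : ℝ) ∈ timeInterval T :=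
    ⟨le_rfl, (EReal.coe_le_coe_iff.2 ht.1).trans_lt ht.2⟩
  have hle := hanti h0 ht ht.1
  simp only [hx, hy, hf.1, hg.1, sub_self, ne_eq, OfNat.ofNat_ne_zero, not_false_eq_true, zero_pow,
    Finset.sum_const_zero] at hle
  have hzero := (Finset.sum_eq_zero_iff_of_nonneg fun v _ => sq_nonneg _).1
    (le_antisymm hle (Finset.sum_nonneg fun v _ => sq_nonneg _))
  ext v
  apply uCoord_injective (hε v)
  have := hzero v (Finset.mem_univ v)
  exact sub_eq_zero.1 (pow_eq_zero_iff two_ne_zero |>.1 this)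

end TriangulatedSurface

theorem theorem3p8 {F : Type*} [Fintype F] [Nonempty F] (S : TriangulatedSurface F)
    (ε : S.Vertex → ℝ) (hε : ∀ v, ε v = 0 ∨ ε v = 1) (η : S.Edge → ℝ)
    (h₁ : S.StructureCondition₁ ε η) (h₂ : S.StructureCondition₂ ε η)
    (Kbar : S.Vertex → ℝ) (f₀ : S.Vertex → ℝ) :
    (∃ T : EReal, 0 < T ∧ ∃ f : ℝ → S.Vertex → ℝ, S.IsExtendedRicciFlow ε η Kbar f₀ T f) ∧
    ∀ (T : EReal) (f g : ℝ → S.Vertex → ℝ),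
      S.IsExtendedRicciFlow ε η Kbar f₀ T f → S.IsExtendedRicciFlow ε η Kbar f₀ T g →
      ∀ t ∈ TriangulatedSurface.timeInterval T, f t = g t :=
  ⟨TriangulatedSurface.exists_isExtendedRicciFlow hε h₁ h₂ Kbar f₀,
    fun _ _ _ hf hg _ ht => hf.eqOn hε h₁ h₂ hg ht⟩
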